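/- Let $I$ be a countable set and let $P(t,x,y)=P_{xy}(t)$ ($t\ge 0$, $x,y\in I$) be a transition probability function on $I$ that is honest, $\sum_{y}P_{xy}(t)=1$, and standard, $\lim_{t\downarrow0}P_{xy}(t)=\delta_{xy}$. Suppose that its density matrix $q_{xy}=\lim_{t\downarrow0}(P_{xy}(t)-\delta_{xy})/t$ is regular: $0\le q_{xy}<\infty$ for $x\neq y$, $0<q_x:=-q_{xx}<\infty$, and $\sum_{y}q_{xy}=0$. Let $\{X_t,t\ge0\}$ be a continuous-time Markov chain on a probability space with state space $I$ and transition function $P$. Let $\eta_0=0$, $\eta_{n+1}=\inf\{t>\eta_n: X_t\ne X_{\eta_n}\}$ be its successive discontinuity points, and suppose that $\lim_n\eta_n=\infty$ almost surely. Let $x\in I$ be a state with $\mathbb P(X_0=x)>0$, write $P^x=\mathbb P(\,\cdot\mid X_0=x)$, with expectation $E^x$, and let $\tau_x=\inf\{t>\eta_1:X_t=x\}\in[0,\infty]$ be the first returning time of $x$ (with $\inf\emptyset=\infty$). Put $$S_t(x,x)=\int_0^tP(s,x,x)\,ds,\qquad G_\lambda(x,x)=\int_0^\infty e^{-\lambda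 t}P(t,x,x)\,dt .$$ Let $w:[0,\infty)\to[0,\infty)$ be non-decreasing and, for some $t_0>0$, twice differentiable with $w''(t)<0$ at every $t\ge t_0$, and let $\lim_{t\to\infty}w'(t)=0$. On the event $\tau_x=\infty$ put $w(\tau_x)=\lim_{t\to\infty}w(t)\in[0,\infty]$ and $e^{-\tau_x/t}=0$. Then the following four conditions are equivalent: 1. $E^x(w(\tau_x))<\infty$; 2. $\displaystyle\int^\infty|w''(t)|\,\frac{t}{S_t(x,x)}\,dt<\infty$; 3. $\displaystyle\int^\infty|w''(t)|\,\frac{t}{G_{1/t}(x,x)}\,dt<\infty$; 4. $\displaystyle\int^\infty|w''(t)|\,\bigl(t-t\,E^x(e^{-\tau_x/t})\bigr)\,dt<\infty$. Here $\int^\infty f(t)\,dt<\infty$ means that $f$ is integrable on $(k,\infty)$ for some $k>0$. -/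

import Mathlib

open Set Filter Topology MeasureTheory
open scoped NNReal ENNReal

namespace CTMC

noncomputable section

/-- Kronecker delta. -/
def delta {I : Type*} (x y : I) : ℝ := by
  classical exact if x = y then 1 else 0

/-- `P t x y` is an honest, standard transition probability function on the state space `I`. -/
structure IsTransitionFunction {I : Type*} (P : ℝ≥0 → I → I → ℝ) : Prop where
  nonneg : ∀ t x y, 0 ≤ P t x y
  honest : ∀ t x, HasSum (fun y => P t x y) 1
  zero : ∀ x y, P 0 x y = delta x y
  chapman_kolmogorov : ∀ s t x y, P (s + t) x y = ∑' z, P s x z * P t z y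
  standard : ∀ x y, Tendsto (fun t => P t x y) (𝓝[>] 0) (𝓝 (delta x y))

/-- `Q` is the density matrix of `P` (its right derivative at time zero) and it is regular:
off-diagonal entries are non-negative, `0 < q_x = -q_xx` (finite), and all row sums vanish. -/
structure IsRegularQMatrix {I : Type*} (P : ℝ≥0 → I → I → ℝ) (Q : I → I → ℝ) : Prop where
  tendsto : ∀ x y, Tendsto (fun t : ℝ≥0 => (P t x y - delta x y) / (t : ℝ)) (𝓝[>] 0) (𝓝 (Q x y))
  nonneg : ∀ x y, x ≠ y → 0 ≤ Q x y
  diag_neg : ∀ x, 0 < -Q x x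
  row_sum : ∀ x, HasSum (fun y => Q x y) 0

/-- The discontinuity points of a path: `η_0 = 0` and `η_{n+1} = inf {t > η_n : X_t ≠ X_{η_n}}`,
with `inf ∅ = ∞` (so `η_{n+1} = ∞` if `η_n = ∞`). -/
def jumpTime {Ω I : Type*} (X : ℝ≥0 → Ω → I) : ℕ → Ω → ℝ≥0∞
  | 0, _ => 0
  | n + 1, ω => ⨅ (t : ℝ≥0)
      (_ : jumpTime X n ω < t ∧ X t ω ≠ X (jumpTime X n ω).toNNReal ω), (t : ℝ≥0∞)

/-- The first flying time `η = lim η_n`; the sequence `η_n` is non-decreasing. -/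
def flyingTime {Ω I : Type*} (X : ℝ≥0 → Ω → I) (ω : Ω) : ℝ≥0∞ := ⨆ n, jumpTime X n ω

/-- The first returning time `τ_x = inf {t > η_1 : X_t = x}`, with `inf ∅ = ∞`. -/
def returnTime {Ω I : Type*} (X : ℝ≥0 → Ω → I) (x : I) (ω : Ω) : ℝ≥0∞ :=
  ⨅ (t : ℝ≥0) (_ : jumpTime X 1 ω < t ∧ X t ω = x), (t : ℝ≥0∞)

/-- Under the law `μ`, `X` is a continuous-time Markov chain with honest standard transition
function `P` and regular density matrix `Q`, whose first flying time is almost surely infinite.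
By the definition of `jumpTime`, an infinite flying time forces the path to be constant on each
interval `[η_n, η_{n+1})`, so that almost all paths are right-continuous step functions. -/
structure IsCTMC {Ω I : Type*} [MeasurableSpace Ω] (μ : Measure Ω)
    (X : ℝ≥0 → Ω → I) (P : ℝ≥0 → I → I → ℝ) (Q : I → I → ℝ) : Prop where
  transition : IsTransitionFunction P
  regular : IsRegularQMatrix P Q
  measurable : ∀ t i, MeasurableSet {ω | X t ω = i}
  markov : ∀ (n : ℕ) (t : ℕ → ℝ≥0) (i : ℕ → I), Monotone t →
    μ {ω | ∀ k ≤ n + 1, X (t k) ω = i k} =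
      μ {ω | ∀ k ≤ n, X (t k) ω = i k} *
        ENNReal.ofReal (P (t (n + 1) - t n) (i n) (i (n + 1)))
  flyingTime_eq_top : ∀ᵐ ω ∂μ, flyingTime X ω = ∞

/-- `P^x = μ(· | X_0 = x)`. -/
def startAt {Ω I : Type*} [MeasurableSpace Ω] (μ : Measure Ω) (X : ℝ≥0 → Ω → I) (x : I) :
    Measure Ω :=
  ProbabilityTheory.cond μ {ω | X 0 ω = x}

/-- The occupation integral `S_t(x,y) = ∫_0^t P(s,x,y) ds`. -/
def occupation {I : Type*} (P : ℝ≥0 → I → I → ℝ) (t : ℝ) (x y : I) : ℝ :=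
  ∫ s in (0 : ℝ)..t, P s.toNNReal x y

/-- The resolvent `G_α(x,y) = ∫_0^∞ e^{-α t} P(t,x,y) dt`. -/
def resolvent {I : Type*} (P : ℝ≥0 → I → I → ℝ) (α : ℝ) (x y : I) : ℝ :=
  ∫ t in Ioi (0 : ℝ), Real.exp (-α * t) * P t.toNNReal x y

/-- `w` evaluated at a time in `[0,∞]`, as an element of `[0,∞]`; for non-decreasing `w` the value
at `∞` is `lim_{t → ∞} w(t)`. -/
def weightAt (w : ℝ → ℝ) (u : ℝ≥0∞) : ℝ≥0∞ :=
  if u = ∞ then ⨆ s : ℝ≥0, ENNReal.ofReal (w s) else ENNReal.ofReal (w u.toReal)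

/-- `e^{-lam u}` for a time `u` in `[0,∞]`, with value `0` at `u = ∞`. -/
def expNegAt (lam : ℝ) (u : ℝ≥0∞) : ℝ :=
  if u = ∞ then 0 else Real.exp (-lam * u.toReal)

/-- Condition (C) on a weight function; only the values on `[0,∞)` matter. -/
structure ConditionC (w : ℝ → ℝ) : Prop where
  nonneg : ∀ t, 0 ≤ t → 0 ≤ w t
  mono : MonotoneOn w (Ici 0)
  deriv_tendsto : Tendsto (deriv w) atTop (𝓝 0)
  deriv_two_neg : ∃ t₀ : ℝ, 0 < t₀ ∧ ∀ t, t₀ ≤ t →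
    DifferentiableAt ℝ w t ∧ DifferentiableAt ℝ (deriv w) t ∧ deriv (deriv w) t < 0

/-- `∫^∞ f(t) dt` is finite: `f` is integrable on some neighbourhood of `+∞`. -/
def IntegralFiniteAtTop (f : ℝ → ℝ) : Prop :=
  ∃ k : ℝ, 0 < k ∧ IntegrableOn f (Ioi k)

end

end CTMC

namespace CTMC

/-! Write q = -Q x x, φ(λ) = E^x(e^{-λτ}), G_λ and S_t for the resolvent and occupation integral at
(x,x). The core is the identity G_λ (1 - φ(λ)) = 1/(λ + q), `IsCTMC.resolvent_mul_one_sub_laplace`: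
the first sojourn at x contributes 1/(λ + q) to G_λ, and everything after the return contributes
φ(λ) G_λ. No strong Markov property is invoked. The path is sampled on a grid of step h, where the
simple Markov property yields a renewal equation (`IsCTMC.renewal`); its generating function at
e^{-λh}, multiplied by h, becomes the identity as h ↓ 0. The grid return times converge to τ because
paths with infinite flying time are right-continuous step functions.

3 ⇔ 4: at λ = 1/t the identity reads t/G = (t - tφ)(1/t + q), and the last factor lies between q and
1 + q for t ≥ 1.

1 ⇔ 4 holds for any random time u: by parts, ∫_k^∞ |w''(t)| min(u,t) dt equals w(u) up to a constant
when u ≥ k (`ConcaveFrom.truncatedWeight_ofReal`), while t(1 - e^{-u/t}) lies between min(u,t)/2 and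
min(u,t). Tonelli concludes.

2 ⇔ 3: S_t ≤ e G_{1/t} is immediate. For the converse, Bernoulli's inequality bounds 1 - φ(6λ) by
6(1 - φ(λ)), so the identity gives G_λ ≤ 36 G_{6λ}; the part of G_{6/t} beyond time t is then small
enough to be absorbed (`IsCTMC.resolvent_le_occupation`). -/

/-! ### Regularity of paths with infinite flying time -/

/-- Paths with infinite flying time are right-continuous step functions. -/
theorem exists_const_right_of_flyingTime_eq_top {Ω I : Type*} {X : ℝ≥0 → Ω → I} {ω : Ω}
    (h : flyingTime X ω = ∞) (t : ℝ≥0) :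
    ∃ u : ℝ≥0, t < u ∧ ∀ s, t ≤ s → s < u → X s ω = X t ω := by
  classical
  have hex : ∃ n, (t : ℝ≥0∞) < jumpTime X n ω := by
    have : (t : ℝ≥0∞) < ⨆ n, jumpTime X n ω := by
      change _ < flyingTime X ω
      rw [h]; exact ENNReal.coe_lt_top
    exact lt_iSup_iff.1 this
  obtain ⟨n, hn, hmin⟩ : ∃ n, (t : ℝ≥0∞) < jumpTime X (n + 1) ω ∧ jumpTime X n ω ≤ t := by
    have h0 : Nat.find hex ≠ 0 := by
      intro h0
      have := Nat.find_spec hex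
      rw [h0] at this
      simp [jumpTime] at this
    obtain ⟨n, hn⟩ := Nat.exists_eq_succ_of_ne_zero h0
    refine ⟨n, ?_, ?_⟩
    · have := Nat.find_spec hex
      rwa [hn] at this
    · exact not_lt.1 (Nat.find_min hex (by omega))
  obtain ⟨u, htu, hu⟩ := ENNReal.lt_iff_exists_nnreal_btwn.1 hn
  have key : ∀ s : ℝ≥0, t ≤ s → s < u → X s ω = X (jumpTime X n ω).toNNReal ω := by
    intro s hts hsu
    rcases (hmin.trans (ENNReal.coe_le_coe.2 hts)).eq_or_lt with heq | hlt
    · rw [heq, ENNReal.toNNReal_coe]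
    · by_contra hne
      have h1 : jumpTime X (n + 1) ω ≤ s := iInf₂_le s ⟨hlt, hne⟩
      exact absurd (hu.trans_le h1) (not_lt.2 (ENNReal.coe_le_coe.2 hsu.le))
  have htu' : t < u := ENNReal.coe_lt_coe.1 htu
  exact ⟨u, htu', fun s hts hsu => (key s hts hsu).trans (key t le_rfl htu').symm⟩

/-- If a path is right-continuous, the infimum of the times in `(a, ∞)` at which `X ∈ s` is
attained by `X` as soon as it is finite. -/
theorem mem_of_hitting_eq_coe {Ω I : Type*} {X : ℝ≥0 → Ω → I} {ω : Ω}
    (h : flyingTime X ω = ∞) {a : ℝ≥0∞} {s : Set I} {t : ℝ≥0}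
    (ht : (⨅ (r : ℝ≥0) (_ : a < r ∧ X r ω ∈ s), (r : ℝ≥0∞)) = t) : X t ω ∈ s := by
  by_contra hts
  obtain ⟨u, htu, hu⟩ := exists_const_right_of_flyingTime_eq_top h t
  have : (u : ℝ≥0∞) ≤ t := by
    rw [← ht]
    refine le_iInf₂ fun r hr => ?_
    by_contra hru
    have hru : r < u := ENNReal.coe_lt_coe.1 (not_le.1 hru)
    have htr : t ≤ r := by
      rw [← ENNReal.coe_le_coe, ← ht]
      exact iInf₂_le r hr
    exact hts (hu r htr hru ▸ hr.2)
  exact absurd htu (not_lt.2 (ENNReal.coe_le_coe.1 this))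

theorem jumpTime_one_eq {Ω I : Type*} (X : ℝ≥0 → Ω → I) (ω : Ω) :
    jumpTime X 1 ω = ⨅ (t : ℝ≥0) (_ : 0 < (t : ℝ≥0∞) ∧ X t ω ∈ {y | y ≠ X 0 ω}), (t : ℝ≥0∞) := by
  simp [jumpTime]

/-! ### Return times of discrete skeletons -/

/-- The sequence `Y` is at `x` at time `m` after having left `x` before. -/
def IsReturn {I : Type*} (Y : ℕ → I) (x : I) (m : ℕ) : Prop := Y m = x ∧ ∃ j < m, Y j ≠ x

/-- `m` is the first return time of the sequence `Y` to `x`. -/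
def IsFirstReturn {I : Type*} (Y : ℕ → I) (x : I) (m : ℕ) : Prop :=
  IsReturn Y x m ∧ ∀ i < m, ¬ IsReturn Y x i

/-- The skeleton of the path `ω` with step `h`. -/
def skeleton {Ω I : Type*} (X : ℝ≥0 → Ω → I) (h : ℝ≥0) (ω : Ω) (j : ℕ) : I := X (j * h) ω

/-- The return time to `x` of the skeleton with step `h`. -/
noncomputable def skeletonReturnTime {Ω I : Type*} (X : ℝ≥0 → Ω → I) (x : I) (h : ℝ≥0) (ω : Ω) :
    ℝ≥0∞ :=
  ⨅ (m : ℕ) (_ : IsReturn (skeleton X h ω) x m), ((m * h : ℝ≥0) : ℝ≥0∞)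

/-- A grid point jh off x has j > 0, since the path starts at x; hence η_1 ≤ jh < mh, and every grid
return is a genuine one. Sampling can only delay the return. -/
theorem returnTime_le_skeletonReturnTime {Ω I : Type*} {X : ℝ≥0 → Ω → I} {x : I} {ω : Ω}
    (h0 : X 0 ω = x) {h : ℝ≥0} (hh : 0 < h) :
    returnTime X x ω ≤ skeletonReturnTime X x h ω := by
  refine le_iInf₂ fun m hm => ?_
  obtain ⟨hm, j, hjm, hj⟩ := hm
  refine iInf₂_le _ ⟨?_, hm⟩
  have hj0 : 0 < (j * h : ℝ≥0) := by
    rcases Nat.eq_zero_or_pos j with rfl | hj0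
    · simp [skeleton, h0] at hj
    · positivity
  have h1 : jumpTime X 1 ω ≤ ((j * h : ℝ≥0) : ℝ≥0∞) := by
    rw [jumpTime_one_eq]
    exact iInf₂_le _ ⟨ENNReal.coe_pos.2 hj0, by rw [h0]; exact hj⟩
  refine h1.trans_lt (ENNReal.coe_lt_coe.2 ?_)
  gcongr

/-- Grid points are `h`-dense from the right. -/
theorem exists_grid_point (t : ℝ≥0) {h : ℝ≥0} (hh : 0 < h) :
    ∃ m : ℕ, t ≤ m * h ∧ m * h < t + h := by
  refine ⟨⌈t / h⌉₊, ?_, ?_⟩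
  · exact (div_le_iff₀ hh).1 (Nat.le_ceil _)
  · have := Nat.ceil_lt_add_one (zero_le : 0 ≤ t / h)
    calc (⌈t / h⌉₊ : ℝ≥0) * h < (t / h + 1) * h := by gcongr
      _ = t + h := by rw [add_mul, div_mul_cancel₀ _ hh.ne', one_mul]

/-- The path holds a state other than x on some [s, v) with s = η_1, and holds x on some [t, u) with
t = τ. A grid finer than both intervals meets each of them. -/
theorem eventually_skeletonReturnTime_le {Ω I : Type*} {X : ℝ≥0 → Ω → I} {x : I} {ω : Ω}
    (hω : flyingTime X ω = ∞) (h0 : X 0 ω = x) {t : ℝ≥0} (ht : returnTime X x ω = t) :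
    ∀ᶠ h in 𝓝[>] (0 : ℝ≥0), skeletonReturnTime X x h ω ≤ ((t + h : ℝ≥0) : ℝ≥0∞) := by
  have hxt : X t ω ∈ ({x} : Set I) := mem_of_hitting_eq_coe hω (a := jumpTime X 1 ω) ht
  have hlt : jumpTime X 1 ω ≤ t := by
    rw [← ht]
    exact le_iInf₂ fun r hr => hr.1.le
  obtain ⟨s, hs⟩ : ∃ s : ℝ≥0, (s : ℝ≥0∞) = jumpTime X 1 ω :=
    ⟨_, ENNReal.coe_toNNReal (ne_top_of_le_ne_top ENNReal.coe_ne_top hlt)⟩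
  have hxs : X s ω ∈ {y | y ≠ X 0 ω} :=
    mem_of_hitting_eq_coe hω (a := 0) ((jumpTime_one_eq X ω).symm.trans hs.symm)
  rw [h0] at hxs
  obtain ⟨u, htu, hu⟩ := exists_const_right_of_flyingTime_eq_top hω t
  obtain ⟨v, hsv, hv⟩ := exists_const_right_of_flyingTime_eq_top hω s
  have hst : s ≤ t := by rwa [← hs, ENNReal.coe_le_coe] at hlt
  have hvt : v ≤ t := by
    by_contra hlt'
    exact hxs (by rw [← hv t hst (not_le.1 hlt')]; exact hxt)
  have hpos : 0 < min (u - t) (v - s) := lt_min (tsub_pos_of_lt htu) (tsub_pos_of_lt hsv)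
  filter_upwards [Ioo_mem_nhdsGT hpos] with h hh
  obtain ⟨hh0, hh1⟩ := hh
  have hhu : t + h < u := by
    rw [add_comm]; exact lt_tsub_iff_right.1 (hh1.trans_le (min_le_left _ _))
  have hhv : s + h < v := by
    rw [add_comm]; exact lt_tsub_iff_right.1 (hh1.trans_le (min_le_right _ _))
  obtain ⟨m, hm1, hm2⟩ := exists_grid_point t hh0
  obtain ⟨j, hj1, hj2⟩ := exists_grid_point s hh0
  have hjm : j < m := by
    have : (j * h : ℝ≥0) < m * h := hj2.trans (hhv.trans_le (hvt.trans hm1))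
    exact_mod_cast lt_of_mul_lt_mul_right this zero_le
  refine (iInf₂_le m ⟨?_, j, hjm, ?_⟩).trans (ENNReal.coe_le_coe.2 hm2.le)
  · exact (hu _ hm1 (hm2.trans hhu)).trans hxt
  · change X (j * h) ω ≠ x
    rw [hv _ hj1 (hj2.trans hhv)]
    exact hxs

theorem tendsto_skeletonReturnTime {Ω I : Type*} {X : ℝ≥0 → Ω → I} {x : I} {ω : Ω}
    (hω : flyingTime X ω = ∞) (h0 : X 0 ω = x) :
    Tendsto (fun h => skeletonReturnTime X x h ω) (𝓝[>] 0) (𝓝 (returnTime X x ω)) := by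
  have hle : ∀ᶠ h in 𝓝[>] (0 : ℝ≥0), returnTime X x ω ≤ skeletonReturnTime X x h ω := by
    filter_upwards [self_mem_nhdsWithin] with h hh
    exact returnTime_le_skeletonReturnTime h0 hh
  by_cases hτ : returnTime X x ω = ∞
  · rw [hτ] at hle ⊢
    exact tendsto_const_nhds.congr' (hle.mono fun h hh => (top_le_iff.1 hh).symm)
  · obtain ⟨t, ht⟩ : ∃ t : ℝ≥0, (t : ℝ≥0∞) = returnTime X x ω := ⟨_, ENNReal.coe_toNNReal hτ⟩
    refine tendsto_of_tendsto_of_tendsto_of_le_of_le' tendsto_const_nhds ?_ hle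
      (eventually_skeletonReturnTime_le hω h0 ht.symm)
    rw [← ht]
    refine ENNReal.tendsto_coe.2 ?_
    have : Tendsto (fun h : ℝ≥0 => t + h) (𝓝 0) (𝓝 (t + 0)) := tendsto_const_nhds.add tendsto_id
    rw [add_zero] at this
    exact this.mono_left nhdsWithin_le_nhds

theorem expNegAt_top (lam : ℝ) : expNegAt lam ∞ = 0 := if_pos rfl

theorem expNegAt_of_ne_top (lam : ℝ) {u : ℝ≥0∞} (hu : u ≠ ∞) :
    expNegAt lam u = Real.exp (-lam * u.toReal) := if_neg hu

/-- When τ = ∞ the grid return times are all exactly ∞, so no continuity of the exponential at ∞ is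
needed and the sign of `lam` is free. -/
theorem tendsto_expNegAt_skeletonReturnTime {Ω I : Type*} {X : ℝ≥0 → Ω → I} {x : I} {ω : Ω}
    (hω : flyingTime X ω = ∞) (h0 : X 0 ω = x) (lam : ℝ) :
    Tendsto (fun h => expNegAt lam (skeletonReturnTime X x h ω)) (𝓝[>] 0)
      (𝓝 (expNegAt lam (returnTime X x ω))) := by
  by_cases hτ : returnTime X x ω = ∞
  · refine tendsto_const_nhds.congr' ?_
    filter_upwards [self_mem_nhdsWithin] with h hh
    have := returnTime_le_skeletonReturnTime h0 (show 0 < h from hh)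
    rw [hτ, top_le_iff] at this
    rw [hτ, this]
  · have hT := tendsto_skeletonReturnTime hω h0
    have hne : ∀ᶠ h in 𝓝[>] (0 : ℝ≥0), skeletonReturnTime X x h ω < ∞ :=
      hT.eventually_lt_const (lt_top_iff_ne_top.2 hτ)
    have h1 : Tendsto (fun h => Real.exp (-lam * (skeletonReturnTime X x h ω).toReal)) (𝓝[>] 0)
        (𝓝 (Real.exp (-lam * (returnTime X x ω).toReal))) :=
      (Real.continuous_exp.tendsto _).comp
        (((ENNReal.tendsto_toReal hτ).comp hT).const_mul (-lam))
    rw [expNegAt_of_ne_top lam hτ]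
    exact h1.congr' (hne.mono fun h hh => (expNegAt_of_ne_top lam hh.ne).symm)

/-! ### The Markov property for events of a skeleton -/

section Markov

variable {Ω I : Type*} {X : ℝ≥0 → Ω → I}

/-- The event `A` depends only on the values of the skeleton up to time `m`. -/
def DeterminedBy (X : ℝ≥0 → Ω → I) (h : ℝ≥0) (m : ℕ) (A : Set Ω) : Prop :=
  ∀ ω ω', (∀ k ≤ m, skeleton X h ω k = skeleton X h ω' k) → ω ∈ A → ω' ∈ A

/-- The first `m + 1` values of the skeleton. -/
def word (X : ℝ≥0 → Ω → I) (h : ℝ≥0) (m : ℕ) (ω : Ω) (k : Fin (m + 1)) : I := skeleton X h ω k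

/-- For countable I there are countably many words, so measurability and the Markov property of such
events reduce to single words. -/
theorem DeterminedBy.eq_biUnion {h : ℝ≥0} {m : ℕ} {A : Set Ω} (hA : DeterminedBy X h m A) :
    A = ⋃ v ∈ word X h m '' A, word X h m ⁻¹' {v} := by
  ext ω
  simp only [mem_iUnion, mem_preimage, mem_singleton_iff, exists_prop, exists_eq_right']
  refine ⟨fun hω => ⟨ω, hω, rfl⟩, ?_⟩
  rintro ⟨ω', hω', he⟩
  exact hA ω' ω (fun k hk => congrFun he ⟨k, by omega⟩) hω'

theorem IsReturn.congr {Y Y' : ℕ → I} {x : I} {m : ℕ} (hk : ∀ k ≤ m, Y k = Y' k)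
    (h : IsReturn Y x m) : IsReturn Y' x m := by
  obtain ⟨h1, j, hj, h2⟩ := h
  exact ⟨(hk m le_rfl).symm.trans h1, j, hj, by rwa [← hk j hj.le]⟩

theorem determinedBy_isFirstReturn (X : ℝ≥0 → Ω → I) (h : ℝ≥0) (x : I) (m : ℕ) :
    DeterminedBy X h m {ω | IsFirstReturn (skeleton X h ω) x m} := by
  rintro ω ω' hk ⟨h1, h2⟩
  exact ⟨h1.congr hk, fun i hi h3 =>
    h2 i hi (h3.congr fun k hki => (hk k (hki.trans hi.le)).symm)⟩

theorem IsFirstReturn.unique {Y : ℕ → I} {x : I} {m n : ℕ} (hm : IsFirstReturn Y x m)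
    (hn : IsFirstReturn Y x n) : m = n := by
  rcases lt_trichotomy m n with h | h | h
  · exact absurd hm.1 (hn.2 m h)
  · exact h
  · exact absurd hn.1 (hm.2 n h)

theorem exists_isFirstReturn {Y : ℕ → I} {x : I} {n : ℕ} (hn : IsReturn Y x n) :
    ∃ m ≤ n, IsFirstReturn Y x m := by
  classical
  have hex : ∃ m, IsReturn Y x m := ⟨n, hn⟩
  exact ⟨Nat.find hex, Nat.find_min' hex hn, Nat.find_spec hex, fun i hi => Nat.find_min hex hi⟩

theorem skeletonReturnTime_of_isFirstReturn {x : I} {h : ℝ≥0} {ω : Ω} {m : ℕ}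
    (hm : IsFirstReturn (skeleton X h ω) x m) :
    skeletonReturnTime X x h ω = ((m * h : ℝ≥0) : ℝ≥0∞) := by
  refine le_antisymm (iInf₂_le m hm.1) (le_iInf₂ fun n hn => ENNReal.coe_le_coe.2 ?_)
  have : m ≤ n := not_lt.1 fun hlt => hm.2 n hlt hn
  gcongr

/-- First returns are unique, so at most one term is nonzero; if there is none, both sides vanish by
the convention at ∞. -/
theorem hasSum_expNegAt_skeletonReturnTime (X : ℝ≥0 → Ω → I) (x : I) (h : ℝ≥0) (ω : Ω) (lam : ℝ) :
    HasSum (fun m : ℕ => {ω | IsFirstReturn (skeleton X h ω) x m}.indicator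
      (fun _ => Real.exp (-lam * h) ^ m) ω) (expNegAt lam (skeletonReturnTime X x h ω)) := by
  by_cases hex : ∃ m, IsFirstReturn (skeleton X h ω) x m
  · obtain ⟨m, hm⟩ := hex
    have : expNegAt lam (skeletonReturnTime X x h ω) =
        {ω | IsFirstReturn (skeleton X h ω) x m}.indicator
          (fun _ => Real.exp (-lam * h) ^ m) ω := by
      rw [skeletonReturnTime_of_isFirstReturn hm, expNegAt_of_ne_top _ ENNReal.coe_ne_top,
        indicator_of_mem (s := {ω | IsFirstReturn (skeleton X h ω) x m}) hm, ← Real.exp_nat_mul, ENNReal.coe_toReal]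
      push_cast
      congr 1
      ring
    rw [this]
    exact hasSum_single m fun n hn => 
      indicator_of_notMem (s := {ω | IsFirstReturn (skeleton X h ω) x n})
        (fun hn' => hn (IsFirstReturn.unique hn' hm)) _
  · have htop : skeletonReturnTime X x h ω = ∞ := by
      refine iInf₂_eq_top.2 fun m hm => ?_
      obtain ⟨n, _, hn⟩ := exists_isFirstReturn hm
      exact absurd ⟨n, hn⟩ hex
    rw [htop, expNegAt_top]
    convert hasSum_zero with m
    exact indicator_of_notMem (s := {ω | IsFirstReturn (skeleton X h ω) x m})
      (fun hm => hex ⟨m, hm⟩) _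

variable [MeasurableSpace Ω] {μ : Measure Ω} {P : ℝ≥0 → I → I → ℝ} {Q : I → I → ℝ}

theorem IsCTMC.measurableSet_word (hX : IsCTMC μ X P Q) (h : ℝ≥0) (m : ℕ)
    (v : Fin (m + 1) → I) : MeasurableSet (word X h m ⁻¹' {v}) := by
  have : word X h m ⁻¹' {v} = ⋂ k : Fin (m + 1), {ω | X (k * h) ω = v k} := by
    ext ω; simp [word, skeleton, funext_iff]
  rw [this]
  exact MeasurableSet.iInter fun k => hX.measurable _ _

theorem DeterminedBy.measurableSet [Countable I] (hX : IsCTMC μ X P Q) {h : ℝ≥0} {m : ℕ}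
    {A : Set Ω} (hA : DeterminedBy X h m A) : MeasurableSet A := by
  rw [hA.eq_biUnion]
  exact MeasurableSet.biUnion (to_countable _) fun v _ => hX.measurableSet_word h m v

theorem IsCTMC.measure_word_inter (hX : IsCTMC μ X P Q) (h : ℝ≥0) (m : ℕ) (v : Fin (m + 1) → I)
    {t : ℝ≥0} (ht : m * h ≤ t) (z : I) :
    μ (word X h m ⁻¹' {v} ∩ {ω | X t ω = z}) =
      μ (word X h m ⁻¹' {v}) * ENNReal.ofReal (P (t - m * h) (v (Fin.last m)) z) := by
  -- The Markov hypothesis wants an infinite monotone time sequence: the grid up to mh, then t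
  -- forever.
  have hmono : Monotone (fun k : ℕ => if k ≤ m then (k * h : ℝ≥0) else t) := by
    intro a b hab
    dsimp only
    split_ifs with ha hb hb
    · gcongr
    · refine le_trans ?_ ht
      gcongr
    · omega
    · exact le_rfl
  have key := hX.markov m (fun k => if k ≤ m then (k * h : ℝ≥0) else t)
    (fun k => if hk : k ≤ m then v ⟨k, by omega⟩ else z) hmono
  have e1 : {ω | ∀ k ≤ m, X (if k ≤ m then (k * h : ℝ≥0) else t) ω =
      if hk : k ≤ m then v ⟨k, by omega⟩ else z} = word X h m ⁻¹' {v} := by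
    ext ω
    simp only [mem_ofPred_eq, mem_preimage, mem_singleton_iff, funext_iff, word, skeleton]
    constructor
    · intro H k
      have hk : (k : ℕ) ≤ m := by omega
      simpa [hk] using H k hk
    · intro H k hk
      simpa [hk] using H ⟨k, by omega⟩
  have e2 : {ω | ∀ k ≤ m + 1, X (if k ≤ m then (k * h : ℝ≥0) else t) ω =
      if hk : k ≤ m then v ⟨k, by omega⟩ else z} = word X h m ⁻¹' {v} ∩ {ω | X t ω = z} := by
    rw [← e1]
    ext ω
    simp only [mem_ofPred_eq, mem_inter_iff]
    constructor
    · intro H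
      exact ⟨fun k hk => H k (by omega), by simpa using H (m + 1) le_rfl⟩
    · rintro ⟨H, H'⟩ k hk
      rcases Nat.lt_or_ge m k with hmk | hmk
      · have : ¬ k ≤ m := by omega
        simpa [this] using H'
      · exact H k hmk
  rw [e1, e2] at key
  simpa [Fin.last] using key

theorem IsCTMC.measure_inter [Countable I] (hX : IsCTMC μ X P Q) {h : ℝ≥0} {m : ℕ} {A : Set Ω}
    (hA : DeterminedBy X h m A) {y : I} (hy : ∀ ω ∈ A, skeleton X h ω m = y)
    {t : ℝ≥0} (ht : m * h ≤ t) (z : I) :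
    μ (A ∩ {ω | X t ω = z}) = μ A * ENNReal.ofReal (P (t - m * h) y z) := by
  have hd : ∀ B : Set Ω, (word X h m '' A).PairwiseDisjoint
      (fun v => word X h m ⁻¹' {v} ∩ B) := fun B v _ v' _ hne =>
    Disjoint.mono inter_subset_left inter_subset_left
      (Disjoint.preimage _ (disjoint_singleton.2 hne))
  have h1 : μ A = ∑' v : word X h m '' A, μ (word X h m ⁻¹' {v.1}) := by
    conv_lhs => rw [hA.eq_biUnion]
    exact measure_biUnion (to_countable _) (by simpa using hd univ)
      fun v _ => hX.measurableSet_word h m v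
  have h2 : μ (A ∩ {ω | X t ω = z}) =
      ∑' v : word X h m '' A, μ (word X h m ⁻¹' {v.1} ∩ {ω | X t ω = z}) := by
    conv_lhs => rw [hA.eq_biUnion, iUnion₂_inter]
    exact measure_biUnion (to_countable _) (hd _)
      fun v _ => (hX.measurableSet_word h m v).inter (hX.measurable _ _)
  rw [h2, h1, ← ENNReal.tsum_mul_right]
  refine tsum_congr fun v => ?_
  obtain ⟨v, ω, hω, rfl⟩ := v
  rw [hX.measure_word_inter h m _ ht z]
  congr 4
  exact hy ω hω

/-- Intersecting with {X_0 = x} keeps the event determined by the skeleton, and conditioning only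
rescales the measure, so the Markov property passes to P^x. -/
theorem IsCTMC.startAt_inter [Countable I] (hX : IsCTMC μ X P Q) (x : I) {h : ℝ≥0} {m : ℕ}
    {A : Set Ω} (hA : DeterminedBy X h m A) {y : I} (hy : ∀ ω ∈ A, skeleton X h ω m = y)
    {t : ℝ≥0} (ht : m * h ≤ t) (z : I) :
    (startAt μ X x).real (A ∩ {ω | X t ω = z}) =
      (startAt μ X x).real A * P (t - m * h) y z := by
  have hA' : DeterminedBy X h m ({ω | X 0 ω = x} ∩ A) := by
    rintro ω ω' hk ⟨h0, h1⟩
    refine ⟨?_, hA ω ω' hk h1⟩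
    have := hk 0 (Nat.zero_le _)
    simp only [skeleton, Nat.cast_zero, zero_mul] at this
    exact this.symm.trans h0
  have key := hX.measure_inter hA' (fun ω hω => hy ω hω.2) ht z
  simp only [Measure.real, startAt, ProbabilityTheory.cond_apply (hX.measurable 0 x)]
  rw [← inter_assoc, key, ← mul_assoc, ENNReal.toReal_mul,
    ENNReal.toReal_ofReal (hX.transition.nonneg _ _ _)]

theorem startAt_real_inter_zero (hX : IsCTMC μ X P Q) (x : I) (A : Set Ω) :
    (startAt μ X x).real ({ω | X 0 ω = x} ∩ A) = (startAt μ X x).real A := by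
  rw [Measure.real, Measure.real, startAt, ProbabilityTheory.cond_inter_self (hX.measurable 0 x)]

theorem startAt_real_zero (hX : IsCTMC μ X P Q) {x : I} [IsProbabilityMeasure (startAt μ X x)] :
    (startAt μ X x).real {ω | X 0 ω = x} = 1 := by
  simpa using startAt_real_inter_zero hX x univ

theorem IsCTMC.startAt_eq [Countable I] (hX : IsCTMC μ X P Q) {x : I}
    [IsProbabilityMeasure (startAt μ X x)] (t : ℝ≥0) :
    (startAt μ X x).real {ω | X t ω = x} = P t x x := by
  -- The degenerate skeleton with step 0 sees only X_0.
  have hA : DeterminedBy X 0 0 {ω | X 0 ω = x} := by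
    intro ω ω' hk h0
    have := hk 0 le_rfl
    simp only [skeleton, Nat.cast_zero, zero_mul] at this
    exact this.symm.trans h0
  have := hX.startAt_inter x hA (y := x) (fun ω hω => by simpa [skeleton] using hω)
    (t := t) (by simp) x
  rw [startAt_real_inter_zero hX, startAt_real_zero hX] at this
  simpa using this

/-! ### The renewal equation of a skeleton -/

theorem IsCTMC.startAt_stay [Countable I] (hX : IsCTMC μ X P Q) {x : I}
    [IsProbabilityMeasure (startAt μ X x)] (h : ℝ≥0) (n : ℕ) :
    (startAt μ X x).real {ω | ∀ j ≤ n, skeleton X h ω j = x} = P h x x ^ n := by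
  induction n with
  | zero => simpa [skeleton] using startAt_real_zero hX
  | succ n ih =>
    have hA : DeterminedBy X h n {ω | ∀ j ≤ n, skeleton X h ω j = x} :=
      fun ω ω' hk H j hj => (hk j hj).symm.trans (H j hj)
    have := hX.startAt_inter x hA (y := x) (fun ω hω => hω n le_rfl)
      (t := (n + 1 : ℕ) * h) (by gcongr; omega) x
    rw [ih] at this
    have e : ((n + 1 : ℕ) * h - n * h : ℝ≥0) = h := by
      push_cast
      rw [add_mul, one_mul, add_tsub_cancel_left]
    rw [e] at this
    rw [pow_succ, ← this]
    congr 1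
    ext ω
    simp only [mem_ofPred_eq, mem_inter_iff]
    constructor
    · exact fun H => ⟨fun j hj => H j (by omega), H _ le_rfl⟩
    · rintro ⟨H, H'⟩ j hj
      rcases Nat.lt_or_ge n j with hnj | hnj
      · obtain rfl : j = n + 1 := by omega
        exact H'
      · exact H j hnj

/-- The probability that the skeleton first returns at time `m`. -/
noncomputable def firstReturnProb (μ : Measure Ω) (X : ℝ≥0 → Ω → I) (x : I) (h : ℝ≥0) (m : ℕ) :
    ℝ :=
  (startAt μ X x).real {ω | IsFirstReturn (skeleton X h ω) x m}

/-- If X is at x at time nh, then either the skeleton never left x up to n, or it has a unique first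
return m ≤ n, after which the Markov property restarts it from x. The term `m = 0` vanishes, a
return needing an earlier exit. -/
theorem IsCTMC.renewal [Countable I] (hX : IsCTMC μ X P Q) {x : I}
    [IsProbabilityMeasure (startAt μ X x)] (h : ℝ≥0) (n : ℕ) :
    P (n * h) x x = P h x x ^ n +
      ∑ kl ∈ Finset.HasAntidiagonal.antidiagonal n, firstReturnProb μ X x h kl.1 * P (kl.2 * h) x x := by
  have hset : {ω | X (n * h) ω = x} = {ω | ∀ j ≤ n, skeleton X h ω j = x} ∪
      ⋃ m ∈ Finset.range (n + 1),
        ({ω | IsFirstReturn (skeleton X h ω) x m} ∩ {ω | X (n * h) ω = x}) := by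
    ext ω
    simp only [mem_ofPred_eq, mem_union, mem_iUnion, mem_inter_iff, Finset.mem_range]
    constructor
    · intro H
      by_cases hs : ∀ j ≤ n, skeleton X h ω j = x
      · exact Or.inl hs
      · push Not at hs
        obtain ⟨j, hj, hne⟩ := hs
        have hjn : j < n := lt_of_le_of_ne hj fun hjn => hne (hjn ▸ H)
        obtain ⟨m, hm, hf⟩ := exists_isFirstReturn (x := x) (n := n) ⟨H, j, hjn, hne⟩
        exact Or.inr ⟨m, by omega, hf, H⟩
    · rintro (H | ⟨m, _, _, H⟩)
      · exact H n le_rfl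
      · exact H
  have hmeas : ∀ m, MeasurableSet
      ({ω | IsFirstReturn (skeleton X h ω) x m} ∩ {ω | X (n * h) ω = x}) := fun m =>
    ((determinedBy_isFirstReturn X h x m).measurableSet hX).inter (hX.measurable _ _)
  rw [← hX.startAt_eq (x := x), hset,
    measureReal_union (h₂ := measure_ne_top _ _), hX.startAt_stay,
    measureReal_biUnion_finset]
  · rw [Finset.Nat.sum_antidiagonal_eq_sum_range_succ_mk]
    congr 1
    refine Finset.sum_congr rfl fun m hm => ?_
    have hmn : m ≤ n := Nat.lt_succ_iff.1 (Finset.mem_range.1 hm)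
    rw [hX.startAt_inter x (determinedBy_isFirstReturn X h x m) (fun ω hω => hω.1.1)
      (by gcongr)]
    simp only [firstReturnProb, Nat.cast_tsub, tsub_mul]
  · intro m _ m' _ hne
    exact disjoint_left.2 fun ω h1 h2 => hne (h1.1.unique h2.1)
  · exact fun m _ => hmeas m
  · refine disjoint_left.2 fun ω h1 h2 => ?_
    simp only [mem_iUnion, mem_inter_iff, Finset.mem_range] at h2
    obtain ⟨m, hm, ⟨⟨_, j, hj, hne⟩, _⟩, _⟩ := h2
    exact hne (h1 j (by omega))
  · exact Finset.measurableSet_biUnion _ fun m _ => hmeas m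

theorem IsTransitionFunction.le_one (hP : IsTransitionFunction P) (t : ℝ≥0) (x y : I) :
    P t x y ≤ 1 :=
  le_hasSum (hP.honest t x) y fun z _ => hP.nonneg t x z

theorem summable_mul_pow_of_le_one {f : ℕ → ℝ} (hf0 : ∀ n, 0 ≤ f n) (hf1 : ∀ n, f n ≤ 1) {a : ℝ}
    (ha0 : 0 ≤ a) (ha1 : a < 1) : Summable fun n => f n * a ^ n :=
  Summable.of_nonneg_of_le (fun n => mul_nonneg (hf0 n) (pow_nonneg ha0 n))
    (fun n => mul_le_of_le_one_left (pow_nonneg ha0 n) (hf1 n))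
    (summable_geometric_of_lt_one ha0 ha1)

/-- The generating function form of the renewal equation. -/
theorem IsCTMC.generatingFunction [Countable I] (hX : IsCTMC μ X P Q) {x : I}
    [IsProbabilityMeasure (startAt μ X x)] (h : ℝ≥0) {a : ℝ} (ha0 : 0 ≤ a) (ha1 : a < 1) :
    (∑' n : ℕ, P (n * h) x x * a ^ n) * (1 - ∑' m, firstReturnProb μ X x h m * a ^ m) =
      (1 - P h x x * a)⁻¹ := by
  have hP0 := hX.transition.nonneg
  have hP1 := hX.transition.le_one
  have hf : Summable fun n : ℕ => P (n * h) x x * a ^ n :=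
    summable_mul_pow_of_le_one (fun n => hP0 _ x x) (fun n => hP1 _ x x) ha0 ha1
  have hr : Summable fun m => firstReturnProb μ X x h m * a ^ m :=
    summable_mul_pow_of_le_one (fun n => measureReal_nonneg) (fun n => measureReal_le_one) ha0 ha1
  have hpa0 : 0 ≤ P h x x * a := mul_nonneg (hP0 _ _ _) ha0
  have hpa1 : P h x x * a < 1 := (mul_le_of_le_one_left ha0 (hP1 _ _ _)).trans_lt ha1
  have hprod := tsum_mul_tsum_eq_tsum_sum_antidiagonal_of_summable_norm hr.norm hf.norm
  have hsum := summable_norm_sum_mul_antidiagonal_of_summable_norm hr.norm hf.norm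
  -- With F and R the two generating functions, the Cauchy product turns the renewal equation into F
  -- = (1 - P h x x * a)⁻¹ + R F.
  have heq : ∑' n : ℕ, P (n * h) x x * a ^ n = (1 - P h x x * a)⁻¹ +
      (∑' m, firstReturnProb μ X x h m * a ^ m) * ∑' n : ℕ, P (n * h) x x * a ^ n := by
    rw [hprod, ← tsum_geometric_of_lt_one hpa0 hpa1,
      ← (summable_geometric_of_lt_one hpa0 hpa1).tsum_add hsum.of_norm]
    refine tsum_congr fun n => ?_
    rw [hX.renewal h n, add_mul, mul_pow, Finset.sum_mul]
    congr 1
    refine Finset.sum_congr rfl fun kl hkl => ?_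
    rw [← Finset.HasAntidiagonal.mem_antidiagonal.1 hkl, pow_add]
    ring
  linarith

theorem IsCTMC.integral_expNegAt_skeletonReturnTime [Countable I] (hX : IsCTMC μ X P Q) {x : I}
    [IsProbabilityMeasure (startAt μ X x)] {h : ℝ≥0} (hh : 0 < h) {lam : ℝ} (hlam : 0 < lam) :
    ∫ ω, expNegAt lam (skeletonReturnTime X x h ω) ∂(startAt μ X x) =
      ∑' m, firstReturnProb μ X x h m * Real.exp (-lam * h) ^ m := by
  have ha0 : 0 ≤ Real.exp (-lam * h) := (Real.exp_pos _).le
  have ha1 : Real.exp (-lam * h) < 1 := by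
    rw [Real.exp_lt_one_iff, neg_mul, neg_lt_zero]
    exact mul_pos hlam (by exact_mod_cast hh)
  have hmeas : ∀ m, MeasurableSet {ω | IsFirstReturn (skeleton X h ω) x m} := fun m =>
    (determinedBy_isFirstReturn X h x m).measurableSet hX
  have hint : ∀ m : ℕ, ∫ ω, {ω | IsFirstReturn (skeleton X h ω) x m}.indicator
      (fun _ => Real.exp (-lam * h) ^ m) ω ∂(startAt μ X x) =
        firstReturnProb μ X x h m * Real.exp (-lam * h) ^ m := fun m => by
    rw [integral_indicator_const _ (hmeas m), smul_eq_mul, firstReturnProb]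
  have hs := hasSum_integral_of_summable_integral_norm (μ := startAt μ X x)
    (F := fun (m : ℕ) ω => {ω | IsFirstReturn (skeleton X h ω) x m}.indicator
      (fun _ => Real.exp (-lam * h) ^ m) ω)
    (fun m => (integrable_const _).indicator (hmeas m)) ?_
  · simp only [hint, fun ω => (hasSum_expNegAt_skeletonReturnTime X x h ω lam).tsum_eq] at hs
    exact hs.tsum_eq.symm
  · have : ∀ (m : ℕ) ω, ‖{ω | IsFirstReturn (skeleton X h ω) x m}.indicator
        (fun _ => Real.exp (-lam * h) ^ m) ω‖ = {ω | IsFirstReturn (skeleton X h ω) x m}.indicator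
        (fun _ => Real.exp (-lam * h) ^ m) ω := fun m ω =>
      Real.norm_of_nonneg (indicator_nonneg (fun _ _ => pow_nonneg ha0 m) ω)
    simp only [this, hint]
    exact summable_mul_pow_of_le_one (fun n => measureReal_nonneg) (fun n => measureReal_le_one)
      ha0 ha1

theorem IsCTMC.measurable_skeletonReturnTime [Countable I] (hX : IsCTMC μ X P Q) (x : I)
    (h : ℝ≥0) : Measurable (skeletonReturnTime X x h) := by
  classical
  have hmeas : ∀ m, MeasurableSet {ω | IsReturn (skeleton X h ω) x m} := fun m =>
    DeterminedBy.measurableSet hX (h := h) (m := m) fun ω ω' hk H => H.congr hk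
  have : skeletonReturnTime X x h = fun ω => ⨅ m : ℕ,
      if ω ∈ {ω | IsReturn (skeleton X h ω) x m} then ((m * h : ℝ≥0) : ℝ≥0∞) else ∞ := by
    ext ω
    refine iInf_congr fun m => ?_
    by_cases hm : IsReturn (skeleton X h ω) x m <;> simp [hm]
  rw [this]
  exact Measurable.iInf fun m => Measurable.ite (hmeas m) measurable_const measurable_const

end Markov

/-! ### Continuity of the transition function -/

section Continuity

variable {I : Type*} {P : ℝ≥0 → I → I → ℝ}

/-- Condition on being at x at time s: P_{s+t}(x,y) and P_t(x,y) both lie between P_s(x,x) P_t(x,y)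
and that quantity plus 1 - P_s(x,x). The bound is uniform in t, so standardness at 0 gives
continuity everywhere. -/
theorem IsTransitionFunction.abs_sub_le (hP : IsTransitionFunction P) (s t : ℝ≥0) (x y : I) :
    |P (s + t) x y - P t x y| ≤ 1 - P s x x := by
  have hnn : ∀ z, 0 ≤ P s x z * P t z y := fun z => mul_nonneg (hP.nonneg _ _ _) (hP.nonneg _ _ _)
  have hle : ∀ z, P s x z * P t z y ≤ P s x z := fun z =>
    mul_le_of_le_one_right (hP.nonneg _ _ _) (hP.le_one _ _ _)
  have hsum : Summable fun z => P s x z * P t z y :=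
    Summable.of_nonneg_of_le hnn hle (hP.honest s x).summable
  have h1 : P s x x * P t x y ≤ P (s + t) x y := by
    rw [hP.chapman_kolmogorov]
    exact hsum.le_tsum x fun z _ => hnn z
  -- The single term z = x of 1 - P_{s+t}(x,y) = ∑_z P_s(x,z)(1 - P_t(z,y)), where honesty is used.
  have h2 : P s x x - P s x x * P t x y ≤ 1 - P (s + t) x y := by
    rw [hP.chapman_kolmogorov]
    exact le_hasSum ((hP.honest s x).sub hsum.hasSum) x fun z _ => sub_nonneg.2 (hle z)
  have h3 := hP.le_one s x x
  have h4 := hP.le_one t x y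
  have h5 := hP.nonneg t x y
  rw [abs_le]
  constructor <;> nlinarith

theorem IsTransitionFunction.continuous (hP : IsTransitionFunction P) (x y : I) :
    Continuous fun t => P t x y := by
  have h0 : Tendsto (fun t => P t x x) (𝓝 0) (𝓝 1) := by
    have h1 : P 0 x x = 1 := by rw [hP.zero, delta, if_pos rfl]
    have : ContinuousWithinAt (fun t => P t x x) (Ioi 0) 0 := by
      rw [ContinuousWithinAt, hP.zero]
      exact hP.standard x x
    rw [continuousWithinAt_Ioi_iff_Ici, show Ici (0 : ℝ≥0) = univ from Ici_bot,
      continuousWithinAt_univ, ContinuousAt, h1] at this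
    exact this
  have key : ∀ s t : ℝ≥0, |P s x y - P t x y| ≤ 1 - P (nndist s t) x x := by
    have aux : ∀ s t : ℝ≥0, t ≤ s → |P s x y - P t x y| ≤ 1 - P (nndist s t) x x := by
      intro s t hts
      have := hP.abs_sub_le (s - t) t x y
      rwa [tsub_add_cancel_of_le hts, ← show nndist s t = s - t by
        rw [NNReal.nndist_eq, tsub_eq_zero_of_le hts, max_eq_left zero_le]] at this
    intro s t
    rcases le_total t s with hts | hst
    · exact aux s t hts
    · rw [abs_sub_comm, nndist_comm]
      exact aux t s hst
  refine continuous_iff_continuousAt.2 fun t => ?_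
  rw [ContinuousAt, tendsto_iff_dist_tendsto_zero]
  have hd : Tendsto (fun s => nndist s t) (𝓝 t) (𝓝 0) := by
    have : Continuous fun s => nndist s t := by fun_prop
    simpa using this.tendsto t
  have hlim : Tendsto (fun s => 1 - P (nndist s t) x x) (𝓝 t) (𝓝 0) := by
    simpa using (h0.comp hd).const_sub 1
  exact squeeze_zero (fun _ => dist_nonneg) (fun s => key s t) hlim

theorem IsTransitionFunction.integrableOn_resolvent (hP : IsTransitionFunction P) (x y : I)
    {lam : ℝ} (hlam : 0 < lam) :
    IntegrableOn (fun t : ℝ => Real.exp (-lam * t) * P t.toNNReal x y) (Ioi 0) := by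
  refine (exp_neg_integrableOn_Ioi 0 hlam).mono' ?_ (ae_of_all _ fun t => ?_)
  · exact (Continuous.mul (by fun_prop)
      ((hP.continuous x y).comp continuous_real_toNNReal)).aestronglyMeasurable
  · rw [norm_mul, Real.norm_of_nonneg (Real.exp_pos _).le, Real.norm_of_nonneg (hP.nonneg _ _ _)]
    exact mul_le_of_le_one_right (Real.exp_pos _).le (hP.le_one _ _ _)

end Continuity

/-! ### Riemann sums on the half-line -/

theorem hasSum_of_integrableOn_floor {g : ℕ → ℝ}
    (hg : IntegrableOn (fun s : ℝ => g ⌊s⌋₊) (Ioi 0)) : HasSum g (∫ s in Ioi (0 : ℝ), g ⌊s⌋₊) := by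
  have hU : ⋃ n : ℕ, Ico (n : ℝ) (n + 1) = Ici 0 := by
    ext s
    simp only [mem_iUnion, mem_Ico, mem_Ici]
    exact ⟨fun ⟨n, hn, _⟩ => (Nat.cast_nonneg n).trans hn,
      fun hs => ⟨⌊s⌋₊, Nat.floor_le hs, Nat.lt_floor_add_one s⟩⟩
  have hfl : ∀ (n : ℕ), ∀ s ∈ Ico (n : ℝ) (n + 1), g ⌊s⌋₊ = g n := fun n s hs => by
    rw [(Nat.floor_eq_iff ((Nat.cast_nonneg n).trans hs.1)).2 hs]
  have := hasSum_integral_iUnion (μ := volume) (s := fun n : ℕ => Ico (n : ℝ) (n + 1))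
    (f := fun s : ℝ => g ⌊s⌋₊) (fun n => measurableSet_Ico) ?_ ?_
  · rw [hU, integral_Ici_eq_integral_Ioi] at this
    have he : (fun n : ℕ => ∫ s in Ico (n : ℝ) (n + 1), g ⌊s⌋₊) = g := by
      ext n
      rw [setIntegral_congr_fun measurableSet_Ico (hfl n)]
      simp
    rwa [he] at this
  · intro m n hmn
    refine disjoint_left.2 fun s hs hs' => hmn ?_
    rw [← (Nat.floor_eq_iff ((Nat.cast_nonneg m).trans hs.1)).2 hs,
      ← (Nat.floor_eq_iff ((Nat.cast_nonneg n).trans hs'.1)).2 hs']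
  · rwa [hU, integrableOn_Ici_iff_integrableOn_Ioi]

theorem exp_pow_floor_le {lam s : ℝ} (hlam : 0 < lam) {h : ℝ} (hh : 0 < h) :
    Real.exp (-lam * h) ^ ⌊s / h⌋₊ ≤ Real.exp (lam * h) * Real.exp (-lam * s) := by
  rw [← Real.exp_nat_mul, ← Real.exp_add, Real.exp_le_exp]
  have h1 : s < (⌊s / h⌋₊ + 1) * h := (div_lt_iff₀ hh).1 (Nat.lt_floor_add_one _)
  nlinarith

theorem tendsto_floor_div_mul {s : ℝ} (hs : 0 ≤ s) :
    Tendsto (fun h : ℝ≥0 => (⌊s / h⌋₊ * h : ℝ)) (𝓝[>] 0) (𝓝 s) := by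
  have hlow : Tendsto (fun h : ℝ≥0 => s - h) (𝓝[>] 0) (𝓝 s) := by
    have : Continuous fun h : ℝ≥0 => s - h := by fun_prop
    simpa using (this.tendsto 0).mono_left nhdsWithin_le_nhds
  refine tendsto_of_tendsto_of_tendsto_of_le_of_le' hlow tendsto_const_nhds ?_ ?_
  · filter_upwards [self_mem_nhdsWithin] with h hh
    have hh' : (0 : ℝ) < h := by exact_mod_cast (show 0 < h from hh)
    have h1 : s < (⌊s / h⌋₊ + 1) * h := (div_lt_iff₀ hh').1 (Nat.lt_floor_add_one _)
    linarith
  · filter_upwards [self_mem_nhdsWithin] with h hh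
    have hh' : (0 : ℝ) < h := by exact_mod_cast (show 0 < h from hh)
    exact (le_div_iff₀ hh').1 (Nat.floor_le (by positivity))

/-! ### The limit of vanishing grid step -/

section Limit

variable {I : Type*} {P : ℝ≥0 → I → I → ℝ}

theorem norm_mul_exp_pow_floor_le (hP : IsTransitionFunction P) (x : I)
    {lam : ℝ} (hlam : 0 < lam) {h : ℝ≥0} (hh : 0 < h) (s : ℝ) :
    ‖P (⌊s / h⌋₊ * h) x x * Real.exp (-lam * h) ^ ⌊s / h⌋₊‖ ≤
      Real.exp (lam * h) * Real.exp (-lam * s) := by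
  rw [norm_mul, Real.norm_of_nonneg (hP.nonneg _ _ _),
    Real.norm_of_nonneg (pow_nonneg (Real.exp_pos _).le _)]
  exact (mul_le_of_le_one_left (pow_nonneg (Real.exp_pos _).le _) (hP.le_one _ _ _)).trans
    (exp_pow_floor_le hlam (by exact_mod_cast hh))

theorem measurable_comp_floor_div (g : ℕ → ℝ) (h : ℝ) : Measurable fun s : ℝ => g ⌊s / h⌋₊ :=
  (measurable_from_nat (f := g)).comp (Nat.measurable_floor.comp (measurable_id.div_const h))

theorem mul_tsum_eq_integral_floor (hP : IsTransitionFunction P) (x : I) {lam : ℝ}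
    (hlam : 0 < lam) {h : ℝ≥0} (hh : 0 < h) :
    h * ∑' n : ℕ, P (n * h) x x * Real.exp (-lam * h) ^ n =
      ∫ s in Ioi (0 : ℝ), P (⌊s / h⌋₊ * h) x x * Real.exp (-lam * h) ^ ⌊s / h⌋₊ := by
  have hh' : (0 : ℝ) < h := by exact_mod_cast hh
  set g : ℕ → ℝ := fun n => P (n * h) x x * Real.exp (-lam * h) ^ n with hg
  have hint : IntegrableOn (fun s : ℝ => g ⌊s / h⌋₊) (Ioi 0) := by
    refine ((exp_neg_integrableOn_Ioi 0 hlam).const_mul (Real.exp (lam * h))).mono'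
      (measurable_comp_floor_div g h).aestronglyMeasurable (ae_of_all _ fun s => ?_)
    exact norm_mul_exp_pow_floor_le hP x hlam hh s
  have hdiv : ∀ s : ℝ, h * s / h = s := fun s => mul_div_cancel_left₀ s hh'.ne'
  have hint' : IntegrableOn (fun s : ℝ => g ⌊s⌋₊) (Ioi 0) := by
    have := (integrableOn_Ioi_comp_mul_left_iff (fun s : ℝ => g ⌊s / h⌋₊) 0 hh').2
      (by rwa [mul_zero])
    simpa only [hdiv] using this
  have hscale := integral_comp_mul_left_Ioi (fun s : ℝ => g ⌊s / h⌋₊) 0 hh'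
  simp only [hdiv, mul_zero] at hscale
  rw [(hasSum_of_integrableOn_floor hint').tsum_eq, hscale, smul_eq_mul,
    mul_inv_cancel_left₀ hh'.ne']

/-- The left side is the integral of a step function converging pointwise to the resolvent
integrand; for h < 1 it is dominated by e^{λ} e^{-λs}. -/
theorem tendsto_mul_tsum (hP : IsTransitionFunction P) (x : I) {lam : ℝ} (hlam : 0 < lam) :
    Tendsto (fun h : ℝ≥0 => (h : ℝ) * ∑' n : ℕ, P (n * h) x x * Real.exp (-lam * h) ^ n)
      (𝓝[>] 0) (𝓝 (resolvent P lam x x)) := by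
  have hev : ∀ᶠ h in 𝓝[>] (0 : ℝ≥0), h ∈ Ioo (0 : ℝ≥0) 1 := Ioo_mem_nhdsGT one_pos
  refine Tendsto.congr' (hev.mono fun h hh => (mul_tsum_eq_integral_floor hP x hlam hh.1).symm) ?_
  refine tendsto_integral_filter_of_dominated_convergence
    (fun s => Real.exp lam * Real.exp (-lam * s)) ?_ ?_ ?_ ?_
  · exact Eventually.of_forall fun h =>
      (measurable_comp_floor_div (fun n => P (n * h) x x * Real.exp (-lam * h) ^ n)
        h).aestronglyMeasurable
  · refine hev.mono fun h hh => ae_of_all _ fun s => ?_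
    refine (norm_mul_exp_pow_floor_le hP x hlam hh.1 s).trans ?_
    have : (h : ℝ) ≤ 1 := by exact_mod_cast hh.2.le
    gcongr
    exact mul_le_of_le_one_right hlam.le this
  · exact (exp_neg_integrableOn_Ioi 0 hlam).const_mul _
  · refine (ae_restrict_iff' measurableSet_Ioi).2 (ae_of_all _ fun s hs => ?_)
    have hfl := tendsto_floor_div_mul (show (0 : ℝ) ≤ s from le_of_lt hs)
    have h1 : Tendsto (fun h : ℝ≥0 => P (⌊s / h⌋₊ * h) x x) (𝓝[>] 0) (𝓝 (P s.toNNReal x x)) := by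
      have := ((hP.continuous x x).tendsto s.toNNReal).comp
        ((continuous_real_toNNReal.tendsto s).comp hfl)
      refine this.congr fun h => ?_
      have : (⌊s / h⌋₊ * h : ℝ).toNNReal = ⌊s / h⌋₊ * h := by
        rw [Real.toNNReal_mul (Nat.cast_nonneg _), Real.toNNReal_coe, Real.toNNReal_natCast]
      simp only [Function.comp_apply, this]
    have h2 : Tendsto (fun h : ℝ≥0 => Real.exp (-lam * h) ^ ⌊s / h⌋₊) (𝓝[>] 0)
        (𝓝 (Real.exp (-lam * s))) := by
      refine ((Real.continuous_exp.tendsto _).comp (hfl.const_mul (-lam))).congr fun h => ?_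
      rw [Function.comp_apply, ← Real.exp_nat_mul]
      congr 1
      ring
    rw [mul_comm (Real.exp _)]
    exact h1.mul h2

/-- The sampled first sojourn becomes 1/(λ + q): the derivative of P_h(x,x) e^{-λh} at h = 0 is Q x
x - λ. -/
theorem tendsto_inv_one_sub_mul_exp {Q : I → I → ℝ}
    (hQ : IsRegularQMatrix P Q) (x : I) {lam : ℝ} (hlam : 0 < lam) :
    Tendsto (fun h : ℝ≥0 => (h : ℝ) * (1 - P h x x * Real.exp (-lam * h))⁻¹) (𝓝[>] 0)
      (𝓝 (lam - Q x x)⁻¹) := by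
  have hq := hQ.diag_neg x
  have hcoe : Tendsto (fun h : ℝ≥0 => (h : ℝ)) (𝓝[>] 0) (𝓝[≠] 0) := by
    refine tendsto_nhdsWithin_iff.2 ⟨?_, ?_⟩
    · exact (NNReal.continuous_coe.tendsto 0).mono_left nhdsWithin_le_nhds
    · filter_upwards [self_mem_nhdsWithin] with h hh
      exact NNReal.coe_ne_zero.2 (ne_of_gt hh)
  have hexp : HasDerivAt (fun h : ℝ => Real.exp (-lam * h)) (-lam) 0 := by
    have := ((hasDerivAt_id (0 : ℝ)).const_mul (-lam)).exp
    simpa using this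
  have h1 : Tendsto (fun h : ℝ≥0 => (Real.exp (-lam * h) - 1) / h) (𝓝[>] 0) (𝓝 (-lam)) := by
    refine ((hasDerivAt_iff_tendsto_slope.1 hexp).comp hcoe).congr fun h => ?_
    simp [slope_def_field]
  have h2 : Tendsto (fun h : ℝ≥0 => Real.exp (-lam * h)) (𝓝[>] 0) (𝓝 1) := by
    have := hexp.continuousAt.tendsto.comp (hcoe.mono_right nhdsWithin_le_nhds)
    simpa [Function.comp_def] using this
  have h3 := hQ.tendsto x x
  rw [delta, if_pos rfl] at h3
  have h4 := ((h3.mul h2).add h1).neg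
  have h5 : -(Q x x * 1 + -lam) = lam - Q x x := by ring
  rw [h5] at h4
  have hne : lam - Q x x ≠ 0 := by linarith
  refine (h4.inv₀ hne).congr' ?_
  filter_upwards [self_mem_nhdsWithin] with h hh
  have hh' : (h : ℝ) ≠ 0 := NNReal.coe_ne_zero.2 (ne_of_gt hh)
  have he : -((P h x x - 1) / h * Real.exp (-lam * h) + (Real.exp (-lam * h) - 1) / h) =
      (1 - P h x x * Real.exp (-lam * h)) / h := by ring
  rw [he, inv_div, div_eq_mul_inv]

end Limit

/-! ### The identity between resolvent and return-time transform -/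

section KeyIdentity

variable {Ω I : Type*} [MeasurableSpace Ω] {μ : Measure Ω} {X : ℝ≥0 → Ω → I}
  {P : ℝ≥0 → I → I → ℝ} {Q : I → I → ℝ}

theorem IsCTMC.ae_startAt (hX : IsCTMC μ X P Q) (x : I) :
    ∀ᵐ ω ∂(startAt μ X x), flyingTime X ω = ∞ ∧ X 0 ω = x :=
  (hX.flyingTime_eq_top.filter_mono ProbabilityTheory.cond_absolutelyContinuous.ae_le).and
    (ProbabilityTheory.ae_cond_mem (hX.measurable 0 x))

/-- An infimum over uncountably many times is not visibly measurable; here it is an almost sure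
limit of grid return times, which are countable infima. -/
theorem IsCTMC.aemeasurable_returnTime [Countable I] (hX : IsCTMC μ X P Q) (x : I) :
    AEMeasurable (returnTime X x) (startAt μ X x) :=
  aemeasurable_of_tendsto_metrizable_ae (𝓝[>] (0 : ℝ≥0))
    (fun h => (hX.measurable_skeletonReturnTime x h).aemeasurable)
    ((hX.ae_startAt x).mono fun _ hω => tendsto_skeletonReturnTime hω.1 hω.2)

theorem measurable_expNegAt (lam : ℝ) : Measurable (expNegAt lam) := by
  refine Measurable.ite (measurableSet_singleton _) measurable_const ?_
  fun_prop

theorem expNegAt_nonneg (lam : ℝ) (u : ℝ≥0∞) : 0 ≤ expNegAt lam u := by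
  unfold expNegAt
  split_ifs
  exacts [le_rfl, (Real.exp_pos _).le]

theorem expNegAt_le_one {lam : ℝ} (hlam : 0 ≤ lam) (u : ℝ≥0∞) : expNegAt lam u ≤ 1 := by
  unfold expNegAt
  split_ifs
  · exact zero_le_one
  · rw [Real.exp_le_one_iff, neg_mul, neg_nonpos]
    positivity

theorem norm_expNegAt_le {lam : ℝ} (hlam : 0 ≤ lam) (u : ℝ≥0∞) : ‖expNegAt lam u‖ ≤ 1 := by
  rw [Real.norm_of_nonneg (expNegAt_nonneg _ _)]
  exact expNegAt_le_one hlam u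

/-- The relation between the resolvent and the Laplace transform of the return time. -/
theorem IsCTMC.resolvent_mul_one_sub_laplace [Countable I] (hX : IsCTMC μ X P Q) {x : I}
    [IsProbabilityMeasure (startAt μ X x)] {lam : ℝ} (hlam : 0 < lam) :
    resolvent P lam x x * (1 - ∫ ω, expNegAt lam (returnTime X x ω) ∂(startAt μ X x)) =
      (lam - Q x x)⁻¹ := by
  have hT : Tendsto (fun h => ∫ ω, expNegAt lam (skeletonReturnTime X x h ω) ∂(startAt μ X x))
      (𝓝[>] 0) (𝓝 (∫ ω, expNegAt lam (returnTime X x ω) ∂(startAt μ X x))) := by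
    refine tendsto_integral_filter_of_dominated_convergence (fun _ => 1) ?_ ?_
      (integrable_const _) ?_
    · exact Eventually.of_forall fun h => ((measurable_expNegAt lam).comp
        (hX.measurable_skeletonReturnTime x h)).aestronglyMeasurable
    · exact Eventually.of_forall fun h => ae_of_all _ fun ω => norm_expNegAt_le hlam.le _
    · exact (hX.ae_startAt x).mono fun ω hω => tendsto_expNegAt_skeletonReturnTime hω.1 hω.2 lam
  -- Both sides are limits of h times the generating function identity at a = e^{-λh}.
  refine tendsto_nhds_unique ((tendsto_mul_tsum hX.transition x hlam).mul (hT.const_sub 1)) ?_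
  refine (tendsto_inv_one_sub_mul_exp hX.regular x hlam).congr' ?_
  filter_upwards [self_mem_nhdsWithin] with h hh
  have hh' : (0 : ℝ) < h := by exact_mod_cast (show 0 < h from hh)
  have ha1 : Real.exp (-lam * h) < 1 := by
    rw [Real.exp_lt_one_iff, neg_mul, neg_lt_zero]
    exact mul_pos hlam hh'
  rw [hX.integral_expNegAt_skeletonReturnTime hh hlam, mul_assoc,
    hX.generatingFunction h (Real.exp_pos _).le ha1]

end KeyIdentity

/-! ### Weighted moments of a random time in `[0, ∞]` -/

section Weight

variable {w : ℝ → ℝ}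

theorem weightAt_top : weightAt w ∞ = ⨆ s : ℝ≥0, ENNReal.ofReal (w s) := if_pos rfl

theorem weightAt_coe (s : ℝ≥0) : weightAt w s = ENNReal.ofReal (w s) := by
  rw [weightAt, if_neg ENNReal.coe_ne_top, ENNReal.coe_toReal]

theorem ConditionC.monotone_weightAt (hw : ConditionC w) : Monotone (weightAt w) := by
  intro u v huv
  induction v with
  | top =>
    induction u with
    | top => exact le_rfl
    | coe s =>
      rw [weightAt_top, weightAt_coe]
      exact le_iSup (fun s : ℝ≥0 => ENNReal.ofReal (w s)) s
  | coe t =>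
    induction u with
    | top => exact absurd huv (by simp)
    | coe s =>
      rw [weightAt_coe, weightAt_coe]
      exact ENNReal.ofReal_le_ofReal (hw.mono s.2 t.2 (by exact_mod_cast huv))

/-- The truncated first moment of `u` against the density `|w''|` on `(k, ∞)`. -/
noncomputable def truncatedWeight (w : ℝ → ℝ) (k : ℝ) (u : ℝ≥0∞) : ℝ≥0∞ :=
  ∫⁻ t in Ioi k, ENNReal.ofReal |deriv (deriv w) t| * min u (ENNReal.ofReal t)

theorem measurable_weight_density (w : ℝ → ℝ) :
    Measurable fun t => ENNReal.ofReal |deriv (deriv w) t| :=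
  ((measurable_deriv (deriv w)).norm).ennreal_ofReal

theorem truncatedWeight_mono (w : ℝ → ℝ) (k : ℝ) : Monotone (truncatedWeight w k) :=
  fun _ _ huv => lintegral_mono fun _ => by gcongr

/-- Monotone convergence: min(n, t) increases to t. -/
theorem truncatedWeight_top (w : ℝ → ℝ) (k : ℝ) :
    truncatedWeight w k ∞ = ⨆ n : ℕ, truncatedWeight w k n := by
  simp only [truncatedWeight]
  rw [← lintegral_iSup]
  · refine lintegral_congr fun t => ?_
    rw [← ENNReal.mul_iSup]
    congr 1
    rw [← iSup_inf_eq, ENNReal.iSup_natCast]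
  · exact fun n => (measurable_weight_density w).mul
      (measurable_const.min measurable_id.ennreal_ofReal)
  · intro m n hmn t
    dsimp only
    gcongr

/-- `w` is concave with decreasing positive slope on `[k, ∞)`. -/
def ConcaveFrom (w : ℝ → ℝ) (k : ℝ) : Prop :=
  ∀ t, k ≤ t → HasDerivAt w (deriv w t) t ∧
    HasDerivAt (deriv w) (deriv (deriv w) t) t ∧ deriv (deriv w) t < 0

theorem ConcaveFrom.mono {k l : ℝ} (h : ConcaveFrom w k) (hkl : k ≤ l) : ConcaveFrom w l :=
  fun t ht => h t (hkl.trans ht)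

theorem ConditionC.exists_concaveFrom (hw : ConditionC w) : ∃ k, 0 < k ∧ ConcaveFrom w k := by
  obtain ⟨k, hk, h⟩ := hw.deriv_two_neg
  exact ⟨k, hk, fun t ht => ⟨(h t ht).1.hasDerivAt, (h t ht).2.1.hasDerivAt, (h t ht).2.2⟩⟩

/-- Integrability of w'' comes from its constant sign together with w' → 0; continuity of w'' is not
available. -/
theorem ConcaveFrom.integral_Ioi {k : ℝ} (h : ConcaveFrom w k)
    (hlim : Tendsto (deriv w) atTop (𝓝 0)) :
    IntegrableOn (fun t => -deriv (deriv w) t) (Ioi k) ∧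
      ∫ t in Ioi k, -deriv (deriv w) t = deriv w k := by
  have hd : ∀ t ∈ Ici k, HasDerivAt (fun t => -deriv w t) (-deriv (deriv w) t) t :=
    fun t ht => (h t ht).2.1.neg
  have hn : ∀ t ∈ Ioi k, 0 ≤ -deriv (deriv w) t := fun t ht => by
    linarith [(h t (le_of_lt ht)).2.2]
  have hl : Tendsto (fun t => -deriv w t) atTop (𝓝 0) := by simpa using hlim.neg
  exact ⟨integrableOn_Ioi_deriv_of_nonneg' hd hn hl, by
    rw [integral_Ioi_of_hasDerivAt_of_nonneg' hd hn hl]; ring⟩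

theorem ConcaveFrom.deriv_nonneg {k : ℝ} (h : ConcaveFrom w k)
    (hlim : Tendsto (deriv w) atTop (𝓝 0)) : 0 ≤ deriv w k := by
  rw [← (h.integral_Ioi hlim).2]
  exact setIntegral_nonneg measurableSet_Ioi fun t ht => by linarith [(h t (le_of_lt ht)).2.2]

/-- Integration by parts for the truncated weight. -/
theorem ConcaveFrom.truncatedWeight_ofReal {k : ℝ} (h : ConcaveFrom w k) (hw : ConditionC w)
    (hk : 0 < k) {a : ℝ} (ha : k ≤ a) :
    truncatedWeight w k (ENNReal.ofReal a) = ENNReal.ofReal (w a - w k + k * deriv w k) := by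
  have hlim := hw.deriv_tendsto
  -- w - t w' is a primitive of -t w''.
  have hψ : ∀ t ∈ uIcc k a,
      HasDerivAt (fun t => w t - t * deriv w t) (-deriv (deriv w) t * t) t := fun t ht => by
    rw [uIcc_of_le ha] at ht
    obtain ⟨h1, h2, -⟩ := h t ht.1
    refine (h1.sub ((hasDerivAt_id t).mul h2)).congr_deriv ?_
    simp only [id]
    ring
  have hint : IntegrableOn (fun t => -deriv (deriv w) t * t) (Ioc k a) := by
    refine intervalIntegral.integrableOn_deriv_of_nonneg
      (g := fun t => w t - t * deriv w t)
      (fun t ht => (hψ t (by rwa [uIcc_of_le ha])).continuousAt.continuousWithinAt)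
      (fun t ht => hψ t (by rw [uIcc_of_le ha]; exact Ioo_subset_Icc_self ht))
      fun t ht => mul_nonneg ?_ (hk.le.trans ht.1.le)
    linarith [(h t ht.1.le).2.2]
  have hI : ∫ t in Ioc k a, -deriv (deriv w) t * t =
      (w a - a * deriv w a) - (w k - k * deriv w k) := by
    rw [← intervalIntegral.integral_of_le ha]
    exact intervalIntegral.integral_eq_sub_of_hasDerivAt hψ
      ((intervalIntegrable_iff_integrableOn_Ioc_of_le ha).2 hint)
  have ha' := h.mono ha
  have h1 : ∫⁻ t in Ioc k a, ENNReal.ofReal |deriv (deriv w) t| *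
      min (ENNReal.ofReal a) (ENNReal.ofReal t) =
        ENNReal.ofReal ((w a - a * deriv w a) - (w k - k * deriv w k)) := by
    rw [← hI, ofReal_integral_eq_lintegral_ofReal hint]
    · refine setLIntegral_congr_fun measurableSet_Ioc fun t ht => ?_
      have hneg := (h t ht.1.le).2.2
      rw [abs_of_neg hneg, min_eq_right (ENNReal.ofReal_le_ofReal ht.2),
        ENNReal.ofReal_mul (by linarith)]
    · refine (ae_restrict_iff' measurableSet_Ioc).2 (ae_of_all _ fun t ht => ?_)
      have hneg := (h t ht.1.le).2.2
      exact mul_nonneg (by linarith) (hk.le.trans ht.1.le)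
  -- Beyond a the minimum is a and the total mass is w'(a); this cancels the boundary term -a w'(a)
  -- from (k, a].
  have h2 : ∫⁻ t in Ioi a, ENNReal.ofReal |deriv (deriv w) t| *
      min (ENNReal.ofReal a) (ENNReal.ofReal t) = ENNReal.ofReal (a * deriv w a) := by
    rw [mul_comm a, ENNReal.ofReal_mul (ha'.deriv_nonneg hlim), ← (ha'.integral_Ioi hlim).2,
      ofReal_integral_eq_lintegral_ofReal (ha'.integral_Ioi hlim).1,
      ← lintegral_mul_const' _ _ ENNReal.ofReal_ne_top]
    · refine setLIntegral_congr_fun measurableSet_Ioi fun t ht => ?_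
      have hneg := (ha' t (le_of_lt ht)).2.2
      rw [abs_of_neg hneg, min_eq_left (ENNReal.ofReal_le_ofReal (le_of_lt ht))]
    · refine (ae_restrict_iff' measurableSet_Ioi).2 (ae_of_all _ fun t ht => ?_)
      have hneg := (ha' t (le_of_lt ht)).2.2
      change 0 ≤ -deriv (deriv w) t
      linarith
  have hnn : 0 ≤ (w a - a * deriv w a) - (w k - k * deriv w k) := by
    rw [← hI]
    refine setIntegral_nonneg measurableSet_Ioc fun t ht => ?_
    have hneg := (h t ht.1.le).2.2
    exact mul_nonneg (by linarith) (hk.le.trans ht.1.le)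
  rw [truncatedWeight, ← Ioc_union_Ioi_eq_Ioi ha,
    lintegral_union measurableSet_Ioi (Ioc_disjoint_Ioi le_rfl), h1, h2,
    ← ENNReal.ofReal_add hnn (mul_nonneg (hk.le.trans ha) (ha'.deriv_nonneg hlim))]
  congr 1
  ring

theorem ConcaveFrom.weightAt_le {k : ℝ} (h : ConcaveFrom w k) (hw : ConditionC w) (hk : 0 < k)
    (u : ℝ≥0∞) : weightAt w u ≤ truncatedWeight w k u + ENNReal.ofReal (w k) := by
  have hcoe : ∀ s : ℝ≥0,
      weightAt w s ≤ truncatedWeight w k s + ENNReal.ofReal (w k) := fun s => by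
    rw [weightAt_coe]
    rcases le_total (s : ℝ) k with hs | hs
    · exact (ENNReal.ofReal_le_ofReal (hw.mono s.2 hk.le hs)).trans le_add_self
    · have hd := mul_nonneg hk.le (h.deriv_nonneg hw.deriv_tendsto)
      have hm : w k ≤ w s := hw.mono hk.le s.2 hs
      rw [← ENNReal.ofReal_coe_nnreal, h.truncatedWeight_ofReal hw hk hs,
        ← ENNReal.ofReal_add (by linarith) (hw.nonneg k hk.le)]
      exact ENNReal.ofReal_le_ofReal (by linarith)
  induction u with
  | coe s => exact hcoe s
  | top =>
    rw [weightAt_top]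
    refine iSup_le fun s => ?_
    rw [← weightAt_coe]
    exact (hcoe s).trans (by gcongr; exact truncatedWeight_mono w k le_top)

theorem ConcaveFrom.truncatedWeight_le {k : ℝ} (h : ConcaveFrom w k) (hw : ConditionC w)
    (hk : 0 < k) (u : ℝ≥0∞) :
    truncatedWeight w k u ≤ weightAt w u + ENNReal.ofReal (k * deriv w k) := by
  have hd := mul_nonneg hk.le (h.deriv_nonneg hw.deriv_tendsto)
  have hcoe : ∀ s : ℝ≥0,
      truncatedWeight w k s ≤ weightAt w s + ENNReal.ofReal (k * deriv w k) := fun s => by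
    rw [weightAt_coe]
    rcases le_total (s : ℝ) k with hs | hs
    · calc truncatedWeight w k s ≤ truncatedWeight w k (ENNReal.ofReal k) := by
            apply truncatedWeight_mono
            rw [← ENNReal.ofReal_coe_nnreal]
            exact ENNReal.ofReal_le_ofReal hs
        _ = ENNReal.ofReal (k * deriv w k) := by
            rw [h.truncatedWeight_ofReal hw hk le_rfl, sub_self, zero_add]
        _ ≤ _ := le_add_self
    · rw [← ENNReal.ofReal_coe_nnreal, h.truncatedWeight_ofReal hw hk hs,
        ← ENNReal.ofReal_add (hw.nonneg s s.2) hd]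
      exact ENNReal.ofReal_le_ofReal (by linarith [hw.nonneg k hk.le])
  induction u with
  | coe s => exact hcoe s
  | top =>
    rw [truncatedWeight_top]
    refine iSup_le fun n => ?_
    have := hcoe n
    rw [ENNReal.coe_natCast] at this
    exact this.trans (by gcongr; exact hw.monotone_weightAt le_top)

/-- From e^{-y} ≤ 1/(1+y) one gets 1 - e^{-y} ≥ y/(1+y) ≥ min(y,1)/2. -/
theorem min_one_le_two_mul_one_sub_exp_neg {y : ℝ} (hy : 0 ≤ y) :
    min y 1 ≤ 2 * (1 - Real.exp (-y)) := by
  have h1 : Real.exp (-y) ≤ (1 + y)⁻¹ := by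
    rw [Real.exp_neg]
    exact inv_anti₀ (by linarith) (by linarith [Real.add_one_le_exp y])
  have h2 : (1 + y) * (1 + y)⁻¹ = 1 := mul_inv_cancel₀ (by linarith)
  have h3 : 0 < (1 + y)⁻¹ := by positivity
  rcases le_total y 1 with h | h
  · rw [min_eq_left h]; nlinarith
  · rw [min_eq_right h]; nlinarith

theorem ofReal_mul_one_sub_expNegAt_le {t : ℝ} (ht : 0 < t) (u : ℝ≥0∞) :
    ENNReal.ofReal (t * (1 - expNegAt (1 / t) u)) ≤ min u (ENNReal.ofReal t) := by
  have h0 := expNegAt_nonneg (1 / t) u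
  refine le_min ?_ (ENNReal.ofReal_le_ofReal (by nlinarith))
  by_cases hu : u = ∞
  · rw [hu]; exact le_top
  · refine ENNReal.ofReal_le_of_le_toReal ?_
    rw [expNegAt_of_ne_top _ hu]
    have h1 := Real.add_one_le_exp (-(1 / t) * u.toReal)
    calc t * (1 - Real.exp (-(1 / t) * u.toReal)) ≤ t * (1 / t * u.toReal) := by
          gcongr; linarith
      _ = u.toReal := by field_simp

theorem min_le_two_mul_ofReal {t : ℝ} (ht : 0 < t) (u : ℝ≥0∞) :
    min u (ENNReal.ofReal t) ≤ 2 * ENNReal.ofReal (t * (1 - expNegAt (1 / t) u)) := by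
  have h2 : (2 : ℝ≥0∞) = ENNReal.ofReal 2 := by simp
  rw [h2, ← ENNReal.ofReal_mul zero_le_two]
  by_cases hu : u = ∞
  · rw [hu, expNegAt_top]
    exact (min_le_right _ _).trans (ENNReal.ofReal_le_ofReal (by linarith))
  · rw [expNegAt_of_ne_top _ hu]
    have h1 := min_one_le_two_mul_one_sub_exp_neg (y := u.toReal / t) (by positivity)
    have h3 : -(1 / t) * u.toReal = -(u.toReal / t) := by ring
    rw [← ENNReal.ofReal_toReal hu, ← ENNReal.ofReal_min, ENNReal.toReal_ofReal (by positivity), h3]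
    refine ENNReal.ofReal_le_ofReal ?_
    have h4 : t * (u.toReal / t) = u.toReal := by field_simp
    calc min u.toReal t = t * min (u.toReal / t) 1 := by
          rw [mul_min_of_nonneg _ _ ht.le, h4, mul_one]
      _ ≤ t * (2 * (1 - Real.exp (-(u.toReal / t)))) := by gcongr
      _ = _ := by ring

theorem measurable_expNegAt_uncurry :
    Measurable fun p : ℝ × ℝ≥0∞ => expNegAt (1 / p.1) p.2 := by
  refine Measurable.ite (measurableSet_eq_fun measurable_snd measurable_const) measurable_const ?_
  fun_prop

/-! ### Averaging over the law of the random time -/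

section Measure

variable (ν : Measure ℝ≥0∞) [IsProbabilityMeasure ν]

theorem integrable_expNegAt {lam : ℝ} (hlam : 0 ≤ lam) : Integrable (expNegAt lam) ν :=
  (integrable_const (1 : ℝ)).mono' (measurable_expNegAt lam).aestronglyMeasurable
    (ae_of_all _ fun u => norm_expNegAt_le hlam u)

theorem measurable_laplace : Measurable fun t : ℝ => ∫ u, expNegAt (1 / t) u ∂ν :=
  (measurable_expNegAt_uncurry.stronglyMeasurable.integral_prod_right' (ν := ν)).measurable

theorem measurable_laplace_weight (w : ℝ → ℝ) : Measurable fun t : ℝ =>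
    |deriv (deriv w) t| * (t - t * ∫ u, expNegAt (1 / t) u ∂ν) :=
  (measurable_deriv (deriv w)).norm.mul
    (measurable_id.sub (measurable_id.mul (measurable_laplace ν)))

theorem laplace_le_one {lam : ℝ} (hlam : 0 ≤ lam) : ∫ u, expNegAt lam u ∂ν ≤ 1 := by
  have := integral_mono (integrable_expNegAt ν hlam) (integrable_const (1 : ℝ))
    fun u => expNegAt_le_one hlam u
  simpa using this

theorem ofReal_laplace_weight (w : ℝ → ℝ) {t : ℝ} (ht : 0 < t) :
    ENNReal.ofReal (|deriv (deriv w) t| * (t - t * ∫ u, expNegAt (1 / t) u ∂ν)) =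
      ∫⁻ u, ENNReal.ofReal |deriv (deriv w) t| *
        ENNReal.ofReal (t * (1 - expNegAt (1 / t) u)) ∂ν := by
  have hl : 0 ≤ 1 / t := by positivity
  have hi : Integrable (fun u => t * (1 - expNegAt (1 / t) u)) ν :=
    ((integrable_const 1).sub (integrable_expNegAt ν hl)).const_mul t
  have he : t - t * ∫ u, expNegAt (1 / t) u ∂ν = ∫ u, t * (1 - expNegAt (1 / t) u) ∂ν := by
    rw [integral_const_mul, integral_sub (integrable_const 1) (integrable_expNegAt ν hl)]
    simp
    ring
  rw [ENNReal.ofReal_mul (abs_nonneg _), he, ofReal_integral_eq_lintegral_ofReal hi,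
    lintegral_const_mul' _ _ ENNReal.ofReal_ne_top]
  exact ae_of_all _ fun u => mul_nonneg ht.le (sub_nonneg.2 (expNegAt_le_one hl u))

theorem lintegral_truncatedWeight (w : ℝ → ℝ) (k : ℝ) :
    ∫⁻ u, truncatedWeight w k u ∂ν = ∫⁻ t in Ioi k, ∫⁻ u,
      ENNReal.ofReal |deriv (deriv w) t| * min u (ENNReal.ofReal t) ∂ν := by
  simp only [truncatedWeight]
  refine lintegral_lintegral_swap (Measurable.aemeasurable ?_)
  exact ((measurable_weight_density w).comp measurable_snd).mul
    (measurable_fst.min measurable_snd.ennreal_ofReal)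

/-- Tonelli, together with the pointwise comparison of t(1 - e^{-u/t}) and min(u,t) within a factor
2. -/
theorem integrableOn_laplace_weight_iff (w : ℝ → ℝ) {k : ℝ} (hk : 0 < k) :
    IntegrableOn (fun t => |deriv (deriv w) t| * (t - t * ∫ u, expNegAt (1 / t) u ∂ν)) (Ioi k) ↔
      ∫⁻ u, truncatedWeight w k u ∂ν < ∞ := by
  have hmeas := (measurable_laplace_weight ν w).aestronglyMeasurable
    (μ := volume.restrict (Ioi k))
  have hnn : 0 ≤ᵐ[volume.restrict (Ioi k)]
      fun t => |deriv (deriv w) t| * (t - t * ∫ u, expNegAt (1 / t) u ∂ν) := by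
    refine (ae_restrict_iff' measurableSet_Ioi).2 (ae_of_all _ fun t ht => ?_)
    have ht0 : 0 < t := hk.trans ht
    have := laplace_le_one ν (lam := 1 / t) (by positivity)
    exact mul_nonneg (abs_nonneg _) (by nlinarith)
  rw [IntegrableOn, Integrable, and_iff_right hmeas, hasFiniteIntegral_iff_ofReal hnn,
    setLIntegral_congr_fun measurableSet_Ioi
      (fun t ht => ofReal_laplace_weight ν w (hk.trans ht)), lintegral_truncatedWeight]
  constructor
  · intro H
    refine lt_of_le_of_lt ?_ (ENNReal.mul_lt_top (a := 2) (by simp) H)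
    rw [← lintegral_const_mul' _ _ (by simp)]
    refine setLIntegral_mono' measurableSet_Ioi fun t ht => ?_
    rw [← lintegral_const_mul' _ _ (by simp)]
    refine lintegral_mono fun u => ?_
    rw [mul_left_comm]
    gcongr
    exact min_le_two_mul_ofReal (hk.trans ht) u
  · refine lt_of_le_of_lt (setLIntegral_mono' measurableSet_Ioi fun t ht => ?_)
    refine lintegral_mono fun u => ?_
    dsimp only
    gcongr
    exact ofReal_mul_one_sub_expNegAt_le (hk.trans ht) u

/-- The `w`-moment of a random time is finite if and only if its Laplace transform is integrable
against `|w''|` at infinity. -/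
theorem lintegral_weightAt_lt_top_iff (hw : ConditionC w) :
    ∫⁻ u, weightAt w u ∂ν < ∞ ↔ IntegralFiniteAtTop
      (fun t => |deriv (deriv w) t| * (t - t * ∫ u, expNegAt (1 / t) u ∂ν)) := by
  obtain ⟨t₀, ht₀, hc⟩ := hw.exists_concaveFrom
  constructor
  · intro H
    refine ⟨t₀, ht₀, (integrableOn_laplace_weight_iff ν w ht₀).2 ?_⟩
    refine (lintegral_mono fun u => hc.truncatedWeight_le hw ht₀ u).trans_lt ?_
    rw [lintegral_add_right _ measurable_const]
    exact ENNReal.add_lt_top.2 ⟨H, by simp⟩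
  · rintro ⟨l, hl, H⟩
    -- The cutoff must lie both in the given range of integrability and where w is concave.
    have hk : 0 < max l t₀ := lt_max_of_lt_left hl
    have hck := hc.mono (le_max_right l t₀)
    have H' := (integrableOn_laplace_weight_iff ν w hk).1
      (H.mono_set (Ioi_subset_Ioi (le_max_left l t₀)))
    refine (lintegral_mono fun u => hck.weightAt_le hw hk u).trans_lt ?_
    rw [lintegral_add_right _ measurable_const]
    exact ENNReal.add_lt_top.2 ⟨H', by simp⟩

end Measure

end Weight

/-! ### Comparison of the occupation integral, the resolvent and the Laplace transform -/

theorem IntegralFiniteAtTop.of_le {f g : ℝ → ℝ} (hf : IntegralFiniteAtTop f) (hg : Measurable g)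
    (C : ℝ) (h : ∀ t, 1 ≤ t → |g t| ≤ C * |f t|) : IntegralFiniteAtTop g := by
  obtain ⟨k, hk, hf⟩ := hf
  refine ⟨max k 1, lt_max_of_lt_left hk, ?_⟩
  refine ((hf.mono_set (Ioi_subset_Ioi (le_max_left k 1))).norm.const_mul C).mono'
    hg.aestronglyMeasurable ?_
  refine (ae_restrict_iff' measurableSet_Ioi).2 (ae_of_all _ fun t ht => h t ?_)
  exact (le_max_right k 1).trans (le_of_lt ht)

section Occupation

variable {I : Type*} {P : ℝ≥0 → I → I → ℝ}

theorem IsTransitionFunction.continuous_toNNReal (hP : IsTransitionFunction P) (x y : I) :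
    Continuous fun t : ℝ => P t.toNNReal x y :=
  (hP.continuous x y).comp continuous_real_toNNReal

theorem IsTransitionFunction.measurable_occupation (hP : IsTransitionFunction P) (x y : I) :
    Measurable fun t => occupation P t x y :=
  (intervalIntegral.continuous_primitive
    (fun a b => (hP.continuous_toNNReal x y).intervalIntegrable a b) 0).measurable

theorem IsTransitionFunction.measurable_resolvent (hP : IsTransitionFunction P) (x y : I) :
    Measurable fun t => resolvent P (1 / t) x y := by
  have : Measurable fun p : ℝ × ℝ => Real.exp (-(1 / p.1) * p.2) * P p.2.toNNReal x y :=
    Measurable.mul (by fun_prop) ((hP.continuous_toNNReal x y).measurable.comp measurable_snd)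
  exact (this.stronglyMeasurable.integral_prod_right' (ν := volume.restrict (Ioi 0))).measurable

theorem IsTransitionFunction.resolvent_nonneg (hP : IsTransitionFunction P) (lam : ℝ) (x y : I) :
    0 ≤ resolvent P lam x y :=
  integral_nonneg fun _ => mul_nonneg (Real.exp_pos _).le (hP.nonneg _ _ _)

theorem IsTransitionFunction.occupation_le (hP : IsTransitionFunction P) {t : ℝ} (ht : 0 < t)
    (x y : I) : occupation P t x y ≤ Real.exp 1 * resolvent P (1 / t) x y := by
  have hint : IntegrableOn (fun s : ℝ => Real.exp 1 * (Real.exp (-(1 / t) * s) * P s.toNNReal x y))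
      (Ioi 0) := (hP.integrableOn_resolvent x y (one_div_pos.2 ht)).const_mul _
  rw [occupation, intervalIntegral.integral_of_le ht.le, resolvent, ← integral_const_mul]
  refine le_trans (setIntegral_mono_on ?_ (hint.mono_set Ioc_subset_Ioi_self) measurableSet_Ioc
    fun s hs => ?_) (setIntegral_mono_set hint ?_ Ioc_subset_Ioi_self.eventuallyLE)
  · exact ((hP.continuous_toNNReal x y).integrableOn_Icc).mono_set Ioc_subset_Icc_self
  · rw [← mul_assoc, ← Real.exp_add]
    refine le_mul_of_one_le_left (hP.nonneg _ _ _) (Real.one_le_exp ?_)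
    have : 1 / t * s ≤ 1 := by
      rw [one_div, inv_mul_le_iff₀ ht, mul_one]
      exact hs.2
    linarith
  · exact ae_of_all _ fun s =>
      mul_nonneg (Real.exp_pos _).le (mul_nonneg (Real.exp_pos _).le (hP.nonneg _ _ _))

/-- Split at t: before t the exponential is at most 1, after t one has e^{-6s/t} ≤ e^{-5} e^{-s/t}.
-/
theorem IsTransitionFunction.resolvent_six_le (hP : IsTransitionFunction P) {t : ℝ} (ht : 0 < t)
    (x y : I) : resolvent P (6 * (1 / t)) x y ≤
      occupation P t x y + Real.exp (-5) * resolvent P (1 / t) x y := by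
  have ht' : 0 < 1 / t := one_div_pos.2 ht
  have h6 := hP.integrableOn_resolvent x y (show 0 < 6 * (1 / t) by positivity)
  have h1 : IntegrableOn (fun s : ℝ => Real.exp (-5) * (Real.exp (-(1 / t) * s) * P s.toNNReal x y))
      (Ioi 0) := (hP.integrableOn_resolvent x y ht').const_mul _
  have hsub : Ioi t ⊆ Ioi 0 := Ioi_subset_Ioi ht.le
  rw [resolvent, ← Ioc_union_Ioi_eq_Ioi ht.le, setIntegral_union (Ioc_disjoint_Ioi le_rfl)
    measurableSet_Ioi (h6.mono_set Ioc_subset_Ioi_self) (h6.mono_set hsub)]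
  refine add_le_add ?_ ?_
  · rw [occupation, intervalIntegral.integral_of_le ht.le]
    refine setIntegral_mono_on (h6.mono_set Ioc_subset_Ioi_self) ?_ measurableSet_Ioc
      fun s hs => mul_le_of_le_one_left (hP.nonneg _ _ _) (Real.exp_le_one_iff.2 ?_)
    · exact ((hP.continuous_toNNReal x y).integrableOn_Icc).mono_set Ioc_subset_Icc_self
    · have : 0 ≤ 1 / t * s := mul_nonneg ht'.le hs.1.le
      linarith
  · rw [resolvent, ← integral_const_mul]
    refine le_trans (setIntegral_mono_on (h6.mono_set hsub) (h1.mono_set hsub) measurableSet_Ioi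
      fun s hs => ?_) (setIntegral_mono_set h1 ?_ hsub.eventuallyLE)
    · rw [← mul_assoc, ← Real.exp_add]
      refine mul_le_mul_of_nonneg_right (Real.exp_le_exp.2 ?_) (hP.nonneg _ _ _)
      have : 1 ≤ 1 / t * s := by
        rw [one_div, le_inv_mul_iff₀ ht, mul_one]
        exact le_of_lt hs
      linarith
    · exact ae_of_all _ fun s =>
        mul_nonneg (Real.exp_pos _).le (mul_nonneg (Real.exp_pos _).le (hP.nonneg _ _ _))

end Occupation

theorem expNegAt_six_mul (lam : ℝ) (u : ℝ≥0∞) : expNegAt (6 * lam) u = expNegAt lam u ^ 6 := by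
  by_cases hu : u = ∞
  · rw [hu, expNegAt_top, expNegAt_top]; norm_num
  · rw [expNegAt_of_ne_top _ hu, expNegAt_of_ne_top _ hu, ← Real.exp_nat_mul]
    congr 1
    push_cast
    ring

/-- Bernoulli's inequality 1 - a^6 ≤ 6(1 - a), applied to a = e^{-λu} and averaged. -/
theorem one_sub_laplace_six_mul_le (ν : Measure ℝ≥0∞) [IsProbabilityMeasure ν] {lam : ℝ}
    (hlam : 0 ≤ lam) :
    1 - ∫ u, expNegAt (6 * lam) u ∂ν ≤ 6 * (1 - ∫ u, expNegAt lam u ∂ν) := by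
  have h1 := integrable_expNegAt ν hlam
  have h6 := integrable_expNegAt ν (show 0 ≤ 6 * lam by positivity)
  have h := integral_mono ((integrable_const (1 : ℝ)).sub h6)
    (((integrable_const (1 : ℝ)).sub h1).const_mul 6) (fun u => by
      have hb := one_add_mul_le_pow (a := expNegAt lam u - 1)
        (by linarith [expNegAt_nonneg lam u]) 6
      simp only [Pi.sub_apply]
      rw [expNegAt_six_mul]
      rw [add_sub_cancel] at hb
      push_cast at hb
      linarith)
  rw [integral_const_mul] at h
  simp only [Pi.sub_apply] at h
  rw [integral_sub (integrable_const _) h6, integral_sub (integrable_const _) h1] at h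
  simpa using h

/-! ### The equivalences for the chain -/

section Main

variable {Ω I : Type*} [MeasurableSpace Ω] [Countable I] {μ : Measure Ω} {X : ℝ≥0 → Ω → I}
  {P : ℝ≥0 → I → I → ℝ} {Q : I → I → ℝ}

theorem IsCTMC.isProbabilityMeasure_map_returnTime (hX : IsCTMC μ X P Q) (x : I)
    [IsProbabilityMeasure (startAt μ X x)] :
    IsProbabilityMeasure ((startAt μ X x).map (returnTime X x)) :=
  Measure.isProbabilityMeasure_map (hX.aemeasurable_returnTime x)

theorem IsCTMC.integral_map_returnTime (hX : IsCTMC μ X P Q) (x : I) (lam : ℝ) :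
    ∫ u, expNegAt lam u ∂((startAt μ X x).map (returnTime X x)) =
      ∫ ω, expNegAt lam (returnTime X x ω) ∂(startAt μ X x) :=
  integral_map (hX.aemeasurable_returnTime x) (measurable_expNegAt lam).aestronglyMeasurable

theorem IsCTMC.resolvent_le_occupation (hX : IsCTMC μ X P Q) {x : I}
    [IsProbabilityMeasure (startAt μ X x)] {t : ℝ} (ht : 0 < t) :
    resolvent P (1 / t) x x ≤ 72 * occupation P t x x := by
  have hP := hX.transition
  have hq := hX.regular.diag_neg x
  have := hX.isProbabilityMeasure_map_returnTime x
  have ht' : 0 < 1 / t := one_div_pos.2 ht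
  have hK1 := hX.resolvent_mul_one_sub_laplace (x := x) ht'
  have hK6 := hX.resolvent_mul_one_sub_laplace (x := x) (show 0 < 6 * (1 / t) by positivity)
  have hφ := one_sub_laplace_six_mul_le ((startAt μ X x).map (returnTime X x)) ht'.le
  rw [hX.integral_map_returnTime, hX.integral_map_returnTime] at hφ
  have hS := hP.resolvent_six_le ht x x
  have hG1 := hP.resolvent_nonneg (1 / t) x x
  have hG6 := hP.resolvent_nonneg (6 * (1 / t)) x x
  set φ₁ := 1 - ∫ ω, expNegAt (1 / t) (returnTime X x ω) ∂(startAt μ X x)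
  set φ₆ := 1 - ∫ ω, expNegAt (6 * (1 / t)) (returnTime X x ω) ∂(startAt μ X x)
  set G₁ := resolvent P (1 / t) x x
  set G₆ := resolvent P (6 * (1 / t)) x x
  have hpos : 0 < G₁ * φ₁ := by
    rw [hK1]
    exact inv_pos.2 (by linarith)
  have hφ1 : 0 < φ₁ := pos_of_mul_pos_right hpos hG1
  -- Equivalent to 6/t + q ≤ 6(1/t + q).
  have hinv : (1 / t - Q x x)⁻¹ ≤ 6 * (6 * (1 / t) - Q x x)⁻¹ := by
    rw [← div_eq_mul_inv, inv_eq_one_div, div_le_div_iff₀ (by linarith) (by linarith)]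
    linarith
  have h36 : G₁ ≤ 36 * G₆ := by
    refine le_of_mul_le_mul_right ?_ hφ1
    calc G₁ * φ₁ ≤ 6 * (G₆ * φ₆) := by rw [hK1, hK6]; exact hinv
      _ ≤ 6 * (G₆ * (6 * φ₁)) := by gcongr
      _ = 36 * G₆ * φ₁ := by ring
  -- Then 36 e^{-5} ≤ 1/2, so G₁ ≤ 36 G₆ ≤ 36 S_t + G₁/2, and the last term is absorbed, giving the
  -- constant 72.
  have he : Real.exp (-5) ≤ 1 / 72 := by
    rw [Real.exp_neg, inv_eq_one_div]
    refine one_div_le_one_div_of_le (by norm_num) ?_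
    have h1 := Real.exp_one_gt_d9
    have h5 : Real.exp 5 = Real.exp 1 ^ 5 := by rw [← Real.exp_nat_mul]; norm_num
    rw [h5]
    calc (72 : ℝ) ≤ 2.7 ^ 5 := by norm_num
      _ ≤ Real.exp 1 ^ 5 := by gcongr; linarith
  nlinarith [mul_le_mul_of_nonneg_right he hG1]

theorem IsCTMC.div_resolvent_eq (hX : IsCTMC μ X P Q) {x : I}
    [IsProbabilityMeasure (startAt μ X x)] {t : ℝ} (ht : 0 < t) :
    0 < resolvent P (1 / t) x x ∧ t / resolvent P (1 / t) x x =
      (t - t * ∫ ω, expNegAt (1 / t) (returnTime X x ω) ∂(startAt μ X x)) * (1 / t - Q x x) := by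
  have hq := hX.regular.diag_neg x
  have ht' : 0 < 1 / t := one_div_pos.2 ht
  have hK := hX.resolvent_mul_one_sub_laplace (x := x) ht'
  have hG := hX.transition.resolvent_nonneg (1 / t) x x
  have hne : 1 / t - Q x x ≠ 0 := by linarith
  set φ := ∫ ω, expNegAt (1 / t) (returnTime X x ω) ∂(startAt μ X x)
  set G := resolvent P (1 / t) x x
  have hG0 : G ≠ 0 := by
    intro h0
    rw [h0, zero_mul] at hK
    exact hne (inv_eq_zero.1 hK.symm)
  refine ⟨lt_of_le_of_ne hG hG0.symm, ?_⟩
  rw [div_eq_iff hG0]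
  calc t = t * ((1 / t - Q x x)⁻¹ * (1 / t - Q x x)) := by rw [inv_mul_cancel₀ hne, mul_one]
    _ = _ := by rw [← hK]; ring

theorem IsCTMC.integralFinite_resolvent_iff_laplace (hX : IsCTMC μ X P Q) {x : I}
    [IsProbabilityMeasure (startAt μ X x)] (w : ℝ → ℝ) :
    IntegralFiniteAtTop (fun t => |deriv (deriv w) t| * (t / resolvent P (1 / t) x x)) ↔
      IntegralFiniteAtTop (fun t => |deriv (deriv w) t| *
        (t - t * ∫ ω, expNegAt (1 / t) (returnTime X x ω) ∂(startAt μ X x))) := by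
  have hq := hX.regular.diag_neg x
  have := hX.isProbabilityMeasure_map_returnTime x
  have hm4 := measurable_laplace_weight ((startAt μ X x).map (returnTime X x)) w
  simp only [hX.integral_map_returnTime] at hm4
  have hm3 : Measurable fun t => |deriv (deriv w) t| * (t / resolvent P (1 / t) x x) :=
    (measurable_deriv (deriv w)).norm.mul
      (measurable_id.div (hX.transition.measurable_resolvent x x))
  -- The integrands differ by the factor 1/t + q exactly; its bounds q and 1 + q supply the two
  -- constants below.
  have key : ∀ t, 1 ≤ t → |(|deriv (deriv w) t| * (t / resolvent P (1 / t) x x))| =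
      |(|deriv (deriv w) t| *
        (t - t * ∫ ω, expNegAt (1 / t) (returnTime X x ω) ∂(startAt μ X x)))| *
        (1 / t - Q x x) := fun t ht => by
    have ht' : 0 < 1 / t := one_div_pos.2 (by linarith)
    rw [(hX.div_resolvent_eq (by linarith)).2, ← mul_assoc, abs_mul _ (1 / t - Q x x),
      abs_of_pos (by linarith : 0 < 1 / t - Q x x)]
  constructor
  · intro H
    refine H.of_le hm4 (-Q x x)⁻¹ fun t ht => ?_
    have ht' : 0 < 1 / t := one_div_pos.2 (by linarith)
    rw [key t ht, ← div_eq_inv_mul, le_div_iff₀ hq]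
    gcongr
    linarith
  · intro H
    refine H.of_le hm3 (1 - Q x x) fun t ht => ?_
    have ht' : 1 / t ≤ 1 := by rw [one_div]; exact inv_le_one_of_one_le₀ ht
    rw [key t ht, mul_comm]
    gcongr

theorem IsCTMC.integralFinite_occupation_iff_resolvent (hX : IsCTMC μ X P Q) {x : I}
    [IsProbabilityMeasure (startAt μ X x)] (w : ℝ → ℝ) :
    IntegralFiniteAtTop (fun t => |deriv (deriv w) t| * (t / occupation P t x x)) ↔
      IntegralFiniteAtTop (fun t => |deriv (deriv w) t| * (t / resolvent P (1 / t) x x)) := by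
  have hm2 : Measurable fun t => |deriv (deriv w) t| * (t / occupation P t x x) :=
    (measurable_deriv (deriv w)).norm.mul
      (measurable_id.div (hX.transition.measurable_occupation x x))
  have hm3 : Measurable fun t => |deriv (deriv w) t| * (t / resolvent P (1 / t) x x) :=
    (measurable_deriv (deriv w)).norm.mul
      (measurable_id.div (hX.transition.measurable_resolvent x x))
  have hpos : ∀ t, 1 ≤ t → 0 < resolvent P (1 / t) x x ∧ 0 < occupation P t x x := fun t ht => by
    have hG := (hX.div_resolvent_eq (x := x) (show 0 < t by linarith)).1
    have := hX.resolvent_le_occupation (x := x) (show 0 < t by linarith)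
    exact ⟨hG, by linarith⟩
  constructor
  · intro H
    refine H.of_le hm3 (Real.exp 1) fun t ht => ?_
    obtain ⟨hG, hS⟩ := hpos t ht
    have ht0 : 0 < t := by linarith
    have h := hX.transition.occupation_le ht0 x x
    rw [abs_mul, abs_mul, abs_abs, abs_of_pos (div_pos ht0 hG), abs_of_pos (div_pos ht0 hS),
      mul_left_comm]
    gcongr
    rw [← mul_div_assoc, div_le_div_iff₀ hG hS]
    nlinarith
  · intro H
    refine H.of_le hm2 72 fun t ht => ?_
    obtain ⟨hG, hS⟩ := hpos t ht
    have ht0 : 0 < t := by linarith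
    have h := hX.resolvent_le_occupation (x := x) ht0
    rw [abs_mul, abs_mul, abs_abs, abs_of_pos (div_pos ht0 hG), abs_of_pos (div_pos ht0 hS),
      mul_left_comm]
    gcongr
    rw [← mul_div_assoc, div_le_div_iff₀ hS hG]
    nlinarith

theorem IsCTMC.lintegral_weightAt_returnTime_lt_top_iff (hX : IsCTMC μ X P Q) {x : I}
    [IsProbabilityMeasure (startAt μ X x)] {w : ℝ → ℝ} (hw : ConditionC w) :
    ∫⁻ ω, weightAt w (returnTime X x ω) ∂(startAt μ X x) < ∞ ↔
      IntegralFiniteAtTop (fun t => |deriv (deriv w) t| *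
        (t - t * ∫ ω, expNegAt (1 / t) (returnTime X x ω) ∂(startAt μ X x))) := by
  have := hX.isProbabilityMeasure_map_returnTime x
  have h := lintegral_weightAt_lt_top_iff ((startAt μ X x).map (returnTime X x)) hw
  rw [lintegral_map' hw.monotone_weightAt.measurable.aemeasurable
    (hX.aemeasurable_returnTime x)] at h
  simpa only [hX.integral_map_returnTime] using h

end Main

end CTMC

theorem theorem3p3 {Ω I : Type*} [MeasurableSpace Ω] [Countable I]
    (μ : MeasureTheory.Measure Ω) [MeasureTheory.IsProbabilityMeasure μ]
    (X : ℝ≥0 → Ω → I) (P : ℝ≥0 → I → I → ℝ) (Q : I → I → ℝ)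
    (hX : CTMC.IsCTMC μ X P Q)
    (x : I) (hx : μ {ω | X 0 ω = x} ≠ 0)
    (w : ℝ → ℝ) (hw : CTMC.ConditionC w) :
    List.TFAE [
      ∫⁻ ω, CTMC.weightAt w (CTMC.returnTime X x ω) ∂(CTMC.startAt μ X x) < ∞,
      CTMC.IntegralFiniteAtTop
        (fun t => |deriv (deriv w) t| * (t / CTMC.occupation P t x x)),
      CTMC.IntegralFiniteAtTop
        (fun t => |deriv (deriv w) t| * (t / CTMC.resolvent P (1 / t) x x)),
      CTMC.IntegralFiniteAtTop
        (fun t => |deriv (deriv w) t| *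
          (t - t * ∫ ω, CTMC.expNegAt (1 / t) (CTMC.returnTime X x ω) ∂(CTMC.startAt μ X x)))] := by
  have : MeasureTheory.IsProbabilityMeasure (CTMC.startAt μ X x) :=
    ProbabilityTheory.cond_isProbabilityMeasure hx
  tfae_have 1 ↔ 4 := hX.lintegral_weightAt_returnTime_lt_top_iff hw
  tfae_have 2 ↔ 3 := hX.integralFinite_occupation_iff_resolvent w
  tfae_have 3 ↔ 4 := hX.integralFinite_resolvent_iff_laplace w
  tfae_finish
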